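/- Let $S$ be a finite set and $m$ a Coxeter matrix on $S$ whose Coxeter group $\mathcal W$ is finite. Let $$\mathcal A=\langle S\mid \mathrm{prod}(s,s',m(s,s'))=\mathrm{prod}(s',s,m(s,s'))\rangle,\qquad \mathrm{prod}(s,s',k)=\underbrace{ss's\cdots}_{k},$$ be the associated Artin group of finite type, $\pi\colon\mathcal A\to\mathcal W$ the natural homomorphism and $\mathcal A^+\subset\mathcal A$ the submonoid generated by $S$; write $x<y$ if $y=xz$ for some $z\in\mathcal A^+$. An atom is an element $A\in\mathcal A^+$ whose word-length equals the length of $\pi(A)$ in $\mathcal W$, and $\Delta$ is the atom that corresponds to the longest element of $\mathcal W$. The element $\Delta^2$ is central; put $\mathcal G=\mathcal A/\langle\Delta^2\rangle$. A product $A_1A_2\cdots A_k$ of nontrivial atoms is a (left greedy) normal form if for every $i$ the atom $A_i$ is the greatest atom, with respect to $<$, that is a prefix of $A_iA_{i+1}\cdots A_k$. The vertex set of the simplicial complex $X(\mathcal G)$ is $V=\mathcal A/\langle\Delta\rangle=\mathcal G/\langle\Delta\rangle$, on which $\mathcal G$ acts by left translation, with base vertex $*=\langle\Delta\rangle$. The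 atomnorm $|v|$ of a vertex $v$ is the number of atoms in the normal form of the unique representative of $v$ in $\mathcal A^+$ whose normal form does not contain $\Delta$, and $d_{at}$ is the unique left-invariant function on $V\times V$ with $d_{at}(*,v)=|v|$ for all $v$. A finite nonempty set of vertices spans a simplex of $X(\mathcal G)$ if and only if $d_{at}(v,w)=1$ for any two distinct elements $v,w$ of it. The group $\mathcal G$ acts simplicially on $X(\mathcal G)$. Theorem. Every finite subgroup $H$ of $\mathcal G$ leaves a simplex of $X(\mathcal G)$ invariant and fixes its barycenter. Moreover, $\mathcal G$ has only finitely many conjugacy classes of finite subgroups. -/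

import Mathlib

open scoped Pointwise

/-! ### Geometric realization of a simplicial complex -/

namespace AbstractSimplicialComplex

/-- The geometric realization of an abstract simplicial complex: its points are given by their
barycentric coordinates, which are positive exactly on the vertices of one simplex, vanish
elsewhere, and sum to `1`. -/
@[ext]
structure Realization {V : Type*} (K : AbstractSimplicialComplex V) where
  weight : V → ℝ
  exists_face : ∃ σ ∈ K.faces, (∀ v ∈ σ, 0 < weight v) ∧ (∀ v ∉ σ, weight v = 0) ∧
    ∑ v ∈ σ, weight v = 1

open Classical in
/-- The barycenter of a simplex. -/
noncomputable def barycenter {V : Type*} (K : AbstractSimplicialComplex V) (σ : Finset V)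
    (hσ : σ ∈ K.faces) : K.Realization where
  weight v := if v ∈ σ then (σ.card : ℝ)⁻¹ else 0
  exists_face := by
    have hne : σ.Nonempty := (K.isRelLowerSet_faces hσ).1
    have hpos : (0 : ℝ) < σ.card := by exact_mod_cast hne.card_pos
    refine ⟨σ, hσ, fun v hv => ?_, fun v hv => by simp [hv], ?_⟩
    · simpa [hv] using hne
    · rw [Finset.sum_congr rfl (fun v hv => if_pos hv)]
      simp [hpos.ne']

end AbstractSimplicialComplex

namespace CoxeterMatrix

variable {B : Type*} (M : CoxeterMatrix B)

/-! ### Artin groups -/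

/-- The alternating product `s t s t ⋯` with `m` factors, starting with `s`. -/
def altProd {G : Type*} [Monoid G] (s t : G) : ℕ → G
  | 0 => 1
  | m + 1 => s * altProd t s m

theorem map_altProd {G H : Type*} [Monoid G] [Monoid H] (f : G →* H) (s t : G) (m : ℕ) :
    f (altProd s t m) = altProd (f s) (f t) m := by
  induction m generalizing s t with
  | zero => simp [altProd]
  | succ m ih => simp [altProd, ih]

/-- The Artin relations `prod(s, t, m(s, t)) = prod(t, s, m(s, t))`. The value `M s t = 0` encodes
`m(s, t) = ∞`, and then the relation is the trivial one. -/
def artinRelations : Set (FreeGroup B) :=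
  Set.range fun p : B × B =>
    altProd (FreeGroup.of p.1) (FreeGroup.of p.2) (M p.1 p.2) *
      (altProd (FreeGroup.of p.2) (FreeGroup.of p.1) (M p.1 p.2))⁻¹

/-- The Artin group `𝒜` of the Coxeter matrix `M`. -/
abbrev ArtinGroup : Type _ := PresentedGroup M.artinRelations

/-- The standard generators of the Artin group. -/
def artinGen (s : B) : M.ArtinGroup := PresentedGroup.of s

theorem altProd_involutions {G : Type*} [Group G] {s t : G} (hs : s * s = 1) (ht : t * t = 1)
    (m : ℕ) : altProd s t m * (altProd t s m)⁻¹ = (s * t) ^ m := by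
  induction m generalizing s t with
  | zero => simp [altProd]
  | succ m ih =>
    have h1 : altProd s t (m + 1) * (altProd t s (m + 1))⁻¹ =
        s * (altProd t s m * (altProd s t m)⁻¹) * t⁻¹ := by
      simp [altProd, mul_assoc]
    have h2 : t⁻¹ = t := inv_eq_of_mul_eq_one_left ht
    rw [h1, ih ht hs, h2]
    clear h1 h2 ih
    induction m with
    | zero => simp
    | succ m ih => rw [pow_succ' (t * s), pow_succ' (s * t), ← ih]; simp [mul_assoc]

theorem altProd_self {G : Type*} [Monoid G] (t : G) (m : ℕ) : altProd t t m = t ^ m := by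
  induction m with
  | zero => simp [altProd]
  | succ m ih => rw [altProd, ih, pow_succ']

/-- The natural homomorphism `π : 𝒜 → 𝒲`, `s ↦ s`, to the Coxeter group. -/
def artinToCoxeter : M.ArtinGroup →* M.Group :=
  PresentedGroup.toGroup (f := M.simple) (by
    rintro _ ⟨⟨s, t⟩, rfl⟩
    have hsq : ∀ i, M.simple i * M.simple i = 1 := M.toCoxeterSystem.simple_mul_simple_self
    have hst : (M.simple s * M.simple t) ^ M s t = 1 :=
      M.toCoxeterSystem.simple_mul_simple_pow s t
    simp only [map_mul, map_inv, map_altProd, FreeGroup.lift_apply_of]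
    rw [altProd_involutions (hsq s) (hsq t), hst])

/-- The homomorphism `length : 𝒜 → ℤ` that sends each generator to `1`. On positive elements it is
the word-length. -/
def artinLength : M.ArtinGroup →* Multiplicative ℤ :=
  PresentedGroup.toGroup (f := fun _ => Multiplicative.ofAdd (1 : ℤ)) (by
    rintro _ ⟨⟨s, t⟩, rfl⟩
    simp only [map_mul, map_inv, map_altProd, FreeGroup.lift_apply_of, altProd_self,
      mul_inv_cancel])

/-- The submonoid `𝒜⁺` of positive elements. -/
def artinPos : Submonoid M.ArtinGroup := Submonoid.closure (Set.range M.artinGen)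

/-- `x < y` in the notation of Deligne: `y = x z` for some positive `z`. -/
def IsPrefix (x y : M.ArtinGroup) : Prop := ∃ z ∈ M.artinPos, y = x * z

/-- An atom is a positive element whose word-length equals the word-length of its image in the
Coxeter group. -/
def IsAtomElt (a : M.ArtinGroup) : Prop :=
  a ∈ M.artinPos ∧
    Multiplicative.toAdd (M.artinLength a) = (M.toCoxeterSystem.length (M.artinToCoxeter a) : ℤ)

theorem exists_isAtomElt (w : M.Group) : ∃ a, M.IsAtomElt a ∧ M.artinToCoxeter a = w := by
  obtain ⟨l, hl, hw⟩ := M.toCoxeterSystem.exists_isReduced w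
  have key : ∀ l : List B, (l.map M.artinGen).prod ∈ M.artinPos ∧
      Multiplicative.toAdd (M.artinLength (l.map M.artinGen).prod) = (l.length : ℤ) ∧
      M.artinToCoxeter (l.map M.artinGen).prod = M.toCoxeterSystem.wordProd l := by
    intro l
    induction l with
    | nil => simp
    | cons s l ih =>
      obtain ⟨h1, h2, h3⟩ := ih
      have e1 : M.artinLength (M.artinGen s) = Multiplicative.ofAdd (1 : ℤ) :=
        PresentedGroup.toGroup.of _
      have e2 : M.artinToCoxeter (M.artinGen s) = M.toCoxeterSystem.simple s :=
        PresentedGroup.toGroup.of _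
      simp only [List.map_cons, List.prod_cons, map_mul, toAdd_mul, List.length_cons,
        CoxeterSystem.wordProd_cons, e1, e2, h2, h3, toAdd_ofAdd]
      refine ⟨mul_mem (Submonoid.subset_closure ⟨s, rfl⟩) h1, ?_, trivial⟩
      push_cast; ring
  obtain ⟨h1, h2, h3⟩ := key l
  refine ⟨_, ⟨h1, ?_⟩, h3.trans hw.symm⟩
  rw [h2, h3, hl]

theorem exists_atom_longest [Finite M.Group] : ∃ D, M.IsAtomElt D ∧
    ∀ w : M.Group, M.toCoxeterSystem.length w ≤ M.toCoxeterSystem.length (M.artinToCoxeter D) := by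
  obtain ⟨w₀, h⟩ := Finite.exists_max M.toCoxeterSystem.length
  obtain ⟨D, hD, rfl⟩ := M.exists_isAtomElt w₀
  exact ⟨D, hD, h⟩

/-- The Garside element `Δ`: the atom that corresponds to the longest element of the finite Coxeter
group. -/
noncomputable def artinDelta [Finite M.Group] : M.ArtinGroup := M.exists_atom_longest.choose

/-! ### Normal forms -/

/-- `a = α(g)`: the atom `a` is a prefix of `g`, and every atom that is a prefix of `g` is a
prefix of `a`. -/
def IsMaxAtom (a g : M.ArtinGroup) : Prop :=
  M.IsAtomElt a ∧ M.IsPrefix a g ∧ ∀ b, M.IsAtomElt b → M.IsPrefix b g → M.IsPrefix b a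

/-- `L = [A₁, …, A_k]` is a left greedy normal form: the `A_i` are nontrivial atoms and
`A_i = α(A_i A_{i+1} ⋯ A_k)` for every `i`. -/
def IsNormalForm (L : List M.ArtinGroup) : Prop :=
  (∀ a ∈ L, M.IsAtomElt a ∧ a ≠ 1) ∧
    ∀ a L', (a :: L') <:+ L → M.IsMaxAtom a (a :: L').prod

/-! ### The group `𝒢 = 𝒜/⟨Δ²⟩` and the complex `X(𝒢)` -/

variable [Finite M.Group]

/-- The group `𝒢 = 𝒜/⟨Δ²⟩`. As `Δ²` is central, the normal closure of `Δ²` is the subgroup that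
it generates. -/
abbrev ArtinQuot : Type _ := M.ArtinGroup ⧸ Subgroup.normalClosure {M.artinDelta ^ 2}

/-- The set of vertices, `𝒢/⟨Δ⟩ = 𝒜/⟨Δ⟩`, on which `𝒢` acts by left translation. -/
abbrev Vertex : Type _ := M.ArtinQuot ⧸ Subgroup.zpowers (M.artinDelta : M.ArtinQuot)

/-- The vertex `g⟨Δ⟩` represented by an element `g` of `𝒜`. -/
noncomputable def toVertex (g : M.ArtinGroup) : M.Vertex := ((g : M.ArtinQuot) : M.Vertex)

/-- The base vertex `*`. -/
noncomputable def baseVertex : M.Vertex := M.toVertex 1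

/-- The atomnorm of a vertex: the number of atoms in the normal form of its special
representative, that is, of its (unique) representative whose normal form contains no `Δ`. -/
noncomputable def atomNorm (v : M.Vertex) : ℕ :=
  sInf {n | ∃ L : List M.ArtinGroup,
    M.IsNormalForm L ∧ M.artinDelta ∉ L ∧ M.toVertex L.prod = v ∧ L.length = n}

/-- The atomdistance: the left-invariant function with `d(*, v) = |v|`. The value
`|g⁻¹ w|` is the same for all `g` with `g * = v`. -/
noncomputable def atomDist (v w : M.Vertex) : ℕ :=
  sInf {n | ∃ g : M.ArtinQuot, g • M.baseVertex = v ∧ M.atomNorm (g⁻¹ • w) = n}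

theorem atomDist_smul (h : M.ArtinQuot) (v w : M.Vertex) :
    M.atomDist (h • v) (h • w) = M.atomDist v w := by
  unfold atomDist
  congr 1
  ext n
  constructor
  · rintro ⟨g, hg, hn⟩
    exact ⟨h⁻¹ * g, by rw [mul_smul, hg, inv_smul_smul], by
      rw [← hn, mul_inv_rev, inv_inv, mul_smul]⟩
  · rintro ⟨g, hg, hn⟩
    exact ⟨h * g, by rw [mul_smul, hg], by
      rw [← hn, mul_inv_rev, mul_smul, inv_smul_smul]⟩

/-- The complex `X(𝒢)`: a finite nonempty set of vertices is a simplex if and only if any two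
distinct elements are at atomdistance `1`. -/
def artinComplex : AbstractSimplicialComplex M.Vertex where
  faces := {σ | σ.Nonempty ∧ ∀ v ∈ σ, ∀ w ∈ σ, v ≠ w → M.atomDist v w = 1}
  isRelLowerSet_faces := by
    rintro σ ⟨hne, hσ⟩
    exact ⟨hne, fun τ hτ hτne => ⟨hτne, fun v hv w hw => hσ v (hτ hv) w (hτ hw)⟩⟩
  singleton_mem v := by
    refine ⟨Finset.singleton_nonempty v, fun a ha b hb hab => absurd ?_ hab⟩
    rw [Finset.mem_singleton.mp ha, Finset.mem_singleton.mp hb]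

theorem map_mem_artinComplex (g : M.ArtinQuot) {σ : Finset M.Vertex}
    (hσ : σ ∈ M.artinComplex.faces) :
    σ.map (MulAction.toPerm g).toEmbedding ∈ M.artinComplex.faces := by
  refine ⟨hσ.1.map, fun v hv w hw hvw => ?_⟩
  obtain ⟨a, ha, rfl⟩ := Finset.mem_map.mp hv
  obtain ⟨b, hb, rfl⟩ := Finset.mem_map.mp hw
  have hab : a ≠ b := fun h => hvw (by rw [h])
  exact (M.atomDist_smul g a b).trans (hσ.2 a ha b hb hab)

/-- The action of `𝒢` on the geometric realization of `X(𝒢)`: the simplicial extension of the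
action on vertices. -/
noncomputable instance : MulAction M.ArtinQuot M.artinComplex.Realization where
  smul g p :=
    { weight := fun v => p.weight (g⁻¹ • v)
      exists_face := by
        obtain ⟨σ, hσ, h1, h2, h3⟩ := p.exists_face
        refine ⟨_, M.map_mem_artinComplex g hσ, fun v hv => ?_, fun v hv => ?_, ?_⟩
        · obtain ⟨a, ha, rfl⟩ := Finset.mem_map.mp hv
          simpa using h1 a ha
        · refine h2 _ fun hmem => hv (Finset.mem_map.mpr ⟨_, hmem, ?_⟩)
          simp
        · rw [Finset.sum_map]
          simpa using h3 }
  one_smul p := by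
    ext v
    change p.weight ((1 : M.ArtinQuot)⁻¹ • v) = p.weight v
    simp
  mul_smul g h p := by
    ext v
    change p.weight ((g * h)⁻¹ • v) = p.weight (h⁻¹ • g⁻¹ • v)
    rw [mul_inv_rev, mul_smul]

end CoxeterMatrix

/-!
Write `x < y` for the prefix order on the Artin group `𝒜`: it is invariant under left translations,
and also under right multiplication by `Δ`, because conjugation by `Δ` permutes the generators.

Suppose that `(𝒜, <)` has joins. For a finite subgroup `H` of `𝒢` with preimage `H̃` in `𝒜`, let `x`
be the join of the elements `h Δ^(-⌊ℓ(h) / ℓ(Δ)⌋)` with `h ∈ H̃`. Such an element depends only on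
the class of `h` modulo `Δ²`, so the join is a finite one. (If `Δ = 1`, then `𝒜` is trivial.) As
`⌊·⌋` is additive up to `1`, translation by `g ∈ H̃` yields `x Δ^k < g x < x Δ^(k+1)` with `k =
⌊ℓ(g) / ℓ(Δ)⌋` (`exists_almost_fixed`). A positive prefix `a` of `Δ` is an atom, and `[a]` is a
normal form, so two distinct vertices `g x *` and `h x *` with `g, h ∈ H̃` are at atomdistance `1`:
the `H`-orbit of `x *` is an invariant simplex. Moreover the conjugate `x⁻¹ H x` is contained in the
finite set of all `Δ^k a` with `a` an atom, which gives the finiteness of the number of conjugacy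
classes.

Joins in `𝒜` come from the braid monoid, the monoid with the same presentation. The weak order of
the finite Coxeter group `𝒲` is controlled by inversion sets (`weakLE_iff_leftInversions_subset`),
and Newman's lemma shows that for all `w`, `v` in `𝒲` there is a greatest prefix `x` of `v` for
which `w x` is reduced (`exists_greatest_reduced_prefix`); this also gives joins in the weak order.
Letting the atom of `w` act on `𝒲` by `v ↦ w x` defines an action of the braid monoid, whose orbit
map at `1` sends `b` to its greatest atom prefix; keeping track of the remaining factor `x⁻¹ v`
shows that the monoid is left cancellative (`absorb_mul`, `IsLongest.split_eq`,
`IsLongest.braidGen_mul_cancel`). Least common multiples of arbitrary elements are then assembled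
from those of atoms (`IsLongest.exists_isLcm`). Since `Δ²` is central and every element divides a
power of it, the monoid is right cancellative and satisfies the Ore condition, and so it embeds into
its group of fractions and hence into `𝒜` (`braidToArtin_injective`).

That the atoms of the braid monoid correspond to the elements of `𝒲` is Matsumoto's theorem
(`prod_map_eq_of_isReduced`). It needs the fact that the order of `s_i s_j` in `𝒲`, for `i ≠ j`, is
`M i j` and not a proper divisor, for which the geometric representation is used.
-/

/-! ### The geometric representation and the order of a product of two simple reflections -/

namespace CoxeterMatrix

variable {B : Type*} (M : CoxeterMatrix B)

/-- The simple coroot of `i`, as a linear form on the space `B →₀ ℝ` with the simple roots as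
basis: its value on the simple root of `j` is `-2 cos (π / M i j)`. For `M i j = 0`, which encodes
`∞`, the value is `-2`, since `π / 0 = 0`. -/
noncomputable def geomCoroot (i : B) : Module.Dual ℝ (B →₀ ℝ) :=
  Finsupp.linearCombination ℝ fun j => -2 * Real.cos (Real.pi / M i j)

theorem geomCoroot_single (i j : B) :
    M.geomCoroot i (Finsupp.single j 1) = -2 * Real.cos (Real.pi / M i j) := by
  simp [geomCoroot]

theorem geomCoroot_self (i : B) : M.geomCoroot i (Finsupp.single i 1) = 2 := by
  simp [geomCoroot_single]

/-- The reflection through which the simple reflection `i` acts in the geometric representation. -/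
noncomputable def geomReflection (i : B) : (B →₀ ℝ) ≃ₗ[ℝ] (B →₀ ℝ) :=
  Module.reflection (M.geomCoroot_self i)

open Polynomial Polynomial.Chebyshev in
theorem chebyshevS_eval_mul_sin (k : ℤ) (θ : ℝ) :
    (S ℝ k).eval (2 * Real.cos θ) * Real.sin θ = Real.sin ((k + 1) * θ) :=
  S_two_mul_real_cos θ k

theorem geomCoroot_mul_sub_two (i j : B) :
    M.geomCoroot i (Finsupp.single j 1) * M.geomCoroot j (Finsupp.single i 1) - 2 =
      2 * Real.cos (2 * (Real.pi / M i j)) := by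
  rw [geomCoroot_single, geomCoroot_single, M.symmetric j i, Real.cos_two_mul]
  ring

theorem sin_two_pi_div_ne_zero {m : ℕ} (hm : 3 ≤ m) : Real.sin (2 * (Real.pi / m)) ≠ 0 := by
  have hm' : (3 : ℝ) ≤ m := by exact_mod_cast hm
  apply ne_of_gt
  apply Real.sin_pos_of_pos_of_lt_pi
  · have := Real.pi_pos
    positivity
  · rw [← mul_div_assoc, div_lt_iff₀ (by linarith)]
    nlinarith [Real.pi_pos]

theorem geomReflection_liftable : M.IsLiftable M.geomReflection := by
  intro i j
  rcases Nat.lt_or_ge (M i j) 3 with h | hm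
  · by_cases hij : i = j
    · subst hij
      rw [M.diagonal, pow_one]
      exact LinearEquiv.ext fun v => Module.involutive_reflection (M.geomCoroot_self i) v
    have h1 : M i j ≠ 1 := M.off_diagonal i j hij
    have h02 : M i j = 0 ∨ M i j = 2 := by omega
    rcases h02 with h0 | h2
    · rw [h0, pow_zero]
    · have e1 : M.geomCoroot i (Finsupp.single j 1) = 0 := by
        simp [geomCoroot_single, h2]
      have e2 : M.geomCoroot j (Finsupp.single i 1) = 0 := by
        simp [geomCoroot_single, M.symmetric j i, h2]
      refine LinearEquiv.ext fun v => ?_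
      simp only [h2, pow_two, geomReflection, LinearEquiv.mul_apply, Module.reflection_apply,
        map_sub, map_smul, e1, e2, geomCoroot_self, LinearEquiv.coe_one, id]
      module
  · have hs := sin_two_pi_div_ne_zero hm
    have hm0 : (M i j : ℝ) ≠ 0 := by
      have : 0 < M i j := by omega
      positivity
    set θ := 2 * (Real.pi / M i j) with hθ
    have hmθ : (M i j : ℝ) * θ = 2 * Real.pi := by rw [hθ]; field_simp
    refine LinearEquiv.ext fun v => ?_
    unfold geomReflection
    rw [Module.reflection_mul_reflection_pow_apply _ _ _ _ (2 * Real.cos θ)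
      (M.geomCoroot_mul_sub_two i j).symm]
    -- For even `m` the polynomial `S_{m/2-1}` vanishes at `2 cos θ`; for odd `m` the sum of two
    -- consecutive polynomials does.
    obtain ⟨k, hk⟩ := Nat.even_or_odd' (M i j)
    rcases hk with hk | hk
    · have hkθ : (k : ℝ) * θ = Real.pi := by
        rw [hk] at hmθ; push_cast at hmθ; linarith
      have hz : (Polynomial.Chebyshev.S ℝ ((k : ℤ) - 1)).eval (2 * Real.cos θ) = 0 := by
        have := chebyshevS_eval_mul_sin (k - 1) θ
        rw [show (((k : ℤ) - 1 : ℤ) : ℝ) + 1 = k by push_cast; ring, hkθ, Real.sin_pi] at this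
        exact (mul_eq_zero.mp this).resolve_right hs
      have a1 : ((M i j : ℤ) - 2) / 2 = k - 1 := by omega
      have a2 : ((M i j : ℤ) - 1) / 2 = k - 1 := by omega
      rw [a1, a2, hz]
      simp
    · have hkθ : (2 * (k : ℝ) + 1) * θ = 2 * Real.pi := by
        rw [hk] at hmθ; push_cast at hmθ; linarith
      have hz : (Polynomial.Chebyshev.S ℝ (k : ℤ)).eval (2 * Real.cos θ) +
          (Polynomial.Chebyshev.S ℝ ((k : ℤ) - 1)).eval (2 * Real.cos θ) = 0 := by
        have e1 := chebyshevS_eval_mul_sin k θ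
        have e2 := chebyshevS_eval_mul_sin (k - 1) θ
        have e3 : ((k : ℤ) : ℝ) * θ + θ = 2 * Real.pi - k * θ := by push_cast; linarith
        have e4 : Real.sin ((((k : ℤ) : ℝ) + 1) * θ) = - Real.sin (k * θ) := by
          rw [add_one_mul, e3, Real.sin_two_pi_sub]
        rw [e4] at e1
        rw [show (((k : ℤ) - 1 : ℤ) : ℝ) + 1 = k by push_cast; ring] at e2
        refine (mul_eq_zero.mp (?_ : _ * Real.sin θ = 0)).resolve_right hs
        rw [add_mul, e1, e2]
        ring
      have a1 : ((M i j : ℤ) - 2) / 2 = k - 1 := by omega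
      have a2 : ((M i j : ℤ) - 1) / 2 = k := by omega
      have a3 : ((M i j : ℤ) - 3) / 2 = k - 1 := by omega
      have a4 : ((M i j : ℤ)) / 2 = k := by omega
      rw [a1, a2, a3, a4, hz]
      simp

theorem dvd_of_geomReflection_mul_pow_eq_one {i j : B} (hij : i ≠ j) {n : ℕ}
    (h : (M.geomReflection i * M.geomReflection j) ^ n = 1) : M i j ∣ n := by
  have key := Module.reflection_mul_reflection_pow_apply_self (M.geomCoroot_self i)
    (M.geomCoroot_self j) n (2 * Real.cos (2 * (Real.pi / M i j)))
    (M.geomCoroot_mul_sub_two i j).symm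
  change ((M.geomReflection i * M.geomReflection j) ^ n) _ = _ at key
  rw [h] at key
  set θ := 2 * (Real.pi / M i j) with hθ
  have kx := DFunLike.congr_fun key i
  have ky := DFunLike.congr_fun key j
  have hgx : M.geomCoroot j (Finsupp.single i 1) = -2 * Real.cos (Real.pi / M i j) := by
    rw [geomCoroot_single, M.symmetric j i]
  rw [hgx] at kx ky
  simp [hij, hij.symm] at kx ky
  rcases Nat.lt_or_ge (M i j) 3 with hlt | hm
  · have h1 : M i j ≠ 1 := M.off_diagonal i j hij
    have h02 : M i j = 0 ∨ M i j = 2 := by omega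
    rcases h02 with h0 | h2
    · have hn : n = 0 := by
        simpa [hθ, h0, Polynomial.Chebyshev.S_eval_two] using ky
      simp [hn]
    · have ht : 2 * Real.cos θ = -2 := by
        rw [hθ, h2, show (2 : ℝ) * (Real.pi / (2 : ℕ)) = Real.pi by push_cast; ring, Real.cos_pi]
        norm_num
      rw [ht, Polynomial.Chebyshev.S_eval_neg_two, Polynomial.Chebyshev.S_eval_neg_two] at kx
      rw [h2]
      by_contra hodd
      have hodd' : Odd n := by rwa [← Nat.not_even_iff_odd, even_iff_two_dvd]
      have hoddZ : Odd (n : ℤ) := by exact_mod_cast hodd'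
      have hevenZ : Even ((n : ℤ) - 1) := by
        obtain ⟨c, hc⟩ := hoddZ
        exact ⟨c, by omega⟩
      rw [Int.negOnePow_odd _ hoddZ, Int.negOnePow_even _ hevenZ] at kx
      push_cast at kx
      linarith
  · have hs := sin_two_pi_div_ne_zero hm
    have hm0 : (M i j : ℝ) ≠ 0 := by
      have : 0 < M i j := by omega
      positivity
    have hc : Real.cos (Real.pi / M i j) ≠ 0 := by
      intro h0
      apply hs
      rw [Real.sin_two_mul, h0, mul_zero]
    have hS : (Polynomial.Chebyshev.S ℝ ((n : ℤ) - 1)).eval (2 * Real.cos θ) = 0 := by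
      rcases ky with ky | ky
      · exact ky
      · exact absurd ky hc
    have e1 := chebyshevS_eval_mul_sin (n - 1) θ
    have e2 := chebyshevS_eval_mul_sin n θ
    rw [show (((n : ℤ) - 1 : ℤ) : ℝ) + 1 = n by push_cast; ring, hS, zero_mul] at e1
    rw [hS, add_zero] at kx
    rw [← kx, one_mul, add_mul, one_mul, Real.sin_add] at e2
    have e1' : Real.sin (((n : ℤ) : ℝ) * θ) = 0 := by exact_mod_cast e1.symm
    rw [e1', zero_mul, zero_add] at e2
    have hcos : Real.cos (((n : ℤ) : ℝ) * θ) = 1 := by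
      have : (Real.cos (((n : ℤ) : ℝ) * θ) - 1) * Real.sin θ = 0 := by linarith
      have := (mul_eq_zero.mp this).resolve_right hs
      linarith
    obtain ⟨k, hk⟩ := (Real.cos_eq_one_iff _).mp hcos
    have hk' : (k : ℝ) * M i j = n := by
      have hpi := Real.pi_ne_zero
      rw [hθ] at hk
      push_cast at hk
      field_simp at hk
      linarith
    have hkZ : k * (M i j : ℤ) = n := by exact_mod_cast hk'
    exact Int.natCast_dvd_natCast.mp ⟨k, by rw [← hkZ, mul_comm]⟩

end CoxeterMatrix

namespace CoxeterSystem

variable {B W : Type*} [Group W] {M : CoxeterMatrix B} (cs : CoxeterSystem M W)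

/-- The order of `s_i s_j` is not a proper divisor of `M i j`, because it is not in the geometric
representation. -/
theorem dvd_of_simple_mul_simple_pow_eq_one {i j : B} (hij : i ≠ j) {n : ℕ}
    (h : (cs.simple i * cs.simple j) ^ n = 1) : M i j ∣ n := by
  apply M.dvd_of_geomReflection_mul_pow_eq_one hij
  have := congrArg (cs.lift ⟨M.geomReflection, M.geomReflection_liftable⟩) h
  simpa [cs.lift_apply_simple M.geomReflection_liftable] using this

end CoxeterSystem

/-! ### Alternating products -/

namespace CoxeterMatrix

theorem altProd_odd_mul {G : Type*} [Monoid G] (s t : G) (k : ℕ) :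
    altProd s t (2 * k + 1) * t = altProd s t (2 * k + 2) := by
  induction k with
  | zero => simp [altProd]
  | succ k ih =>
    change s * (t * altProd s t (2 * k + 1)) * t = s * (t * altProd s t (2 * k + 2))
    rw [← ih]
    simp only [mul_assoc]

theorem altProd_odd_eq {G : Type*} [Monoid G] (s t : G) (k : ℕ) :
    altProd s t (2 * k + 1) = (s * t) ^ k * s := by
  induction k with
  | zero => simp [altProd]
  | succ k ih =>
    change s * (t * altProd s t (2 * k + 1)) = _
    rw [ih, pow_succ']
    simp only [mul_assoc]

theorem altProd_even_eq {G : Type*} [Monoid G] (s t : G) (k : ℕ) :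
    altProd s t (2 * k) = (s * t) ^ k := by
  induction k with
  | zero => simp [altProd]
  | succ k ih =>
    change s * (t * altProd s t (2 * k)) = _
    rw [ih, pow_succ', mul_assoc]

end CoxeterMatrix

namespace CoxeterSystem

open CoxeterMatrix

variable {B W : Type*} [Group W] {M : CoxeterMatrix B} (cs : CoxeterSystem M W)

/-- The alternating word `i j i ⋯` with `k` letters, starting with `i`. (Mathlib's
`alternatingWord` prescribes the last letter instead.) -/
def altList {B : Type*} (i j : B) : ℕ → List B
  | 0 => []
  | k + 1 => i :: altList j i k

@[simp] theorem length_altList (i j : B) (k : ℕ) : (altList i j k).length = k := by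
  induction k generalizing i j with
  | zero => rfl
  | succ k ih => simp [altList, ih]

theorem map_prod_altList {N : Type*} [Monoid N] (f : B → N) (i j : B) (k : ℕ) :
    ((altList i j k).map f).prod = altProd (f i) (f j) k := by
  induction k generalizing i j with
  | zero => rfl
  | succ k ih => simp [altList, altProd, ih]

theorem wordProd_altList (i j : B) (k : ℕ) :
    cs.wordProd (altList i j k) = altProd (cs.simple i) (cs.simple j) k :=
  map_prod_altList _ _ _ _

theorem leftInvSeq_altList (i j : B) (n : ℕ) :
    cs.leftInvSeq (altList i j n) =
      (List.range n).map fun k => altProd (cs.simple i) (cs.simple j) (2 * k + 1) := by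
  induction n generalizing i j with
  | zero => rfl
  | succ n ih =>
    rw [altList, leftInvSeq, ih, List.range_succ_eq_map, List.map_cons, List.map_map, List.map_map]
    congr 1
    · simp [altProd]
    · apply List.map_congr_left
      intro k _
      simp only [Function.comp_apply, MulAut.conj_apply, inv_simple]
      rw [mul_assoc, altProd_odd_mul]
      rfl

/-! ### The inversion set of an element -/

open Classical in
/-- The permutation `(t, ε) ↦ (s t s, ε + [t = s])` of `W × ℤ/2` attached to the simple reflection
`s = s_i`. -/
noncomputable def simplePerm (i : B) : Equiv.Perm (W × ZMod 2) :=
  Function.Involutive.toPerm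
    (fun p => (cs.simple i * p.1 * cs.simple i, p.2 + if p.1 = cs.simple i then 1 else 0)) (by
      rintro ⟨t, ε⟩
      have h : cs.simple i * t * cs.simple i = cs.simple i ↔ t = cs.simple i := by
        rw [mul_eq_right, mul_eq_one_iff_inv_eq, inv_simple, eq_comm]
      ext
      · simp [mul_assoc]
      · simp only [h]
        split_ifs
        · rw [add_assoc, (by decide : (1 : ZMod 2) + 1 = 0), add_zero]
        · simp)

open Classical in
/-- The second coordinate of the action of a word counts, modulo `2`, the occurrences of a given
reflection among the left inversions of the word. -/
theorem simplePerm_prod_inv_apply (ω : List B) (t : W) (ε : ZMod 2) :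
    ((ω.map cs.simplePerm).prod)⁻¹ (t, ε) =
      ((cs.wordProd ω)⁻¹ * t * cs.wordProd ω, ε + ((cs.leftInvSeq ω).count t : ℕ)) := by
  induction ω generalizing t ε with
  | nil => simp
  | cons i ω ih =>
    have hP : (cs.simplePerm i)⁻¹ (t, ε) =
        (cs.simple i * t * cs.simple i, ε + if t = cs.simple i then 1 else 0) := rfl
    rw [List.map_cons, List.prod_cons, mul_inv_rev, Equiv.Perm.mul_apply, hP, ih, wordProd_cons,
      leftInvSeq, List.count_cons]
    have ht : t = MulAut.conj (cs.simple i) (cs.simple i * t * cs.simple i) := by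
      simp [mul_assoc]
    conv_rhs => rw [ht, List.count_map_of_injective _ _ (MulAut.conj (cs.simple i)).injective, ← ht]
    ext
    · simp [mul_assoc]
    · simp only [beq_iff_eq, eq_comm (a := cs.simple i)]
      push_cast
      ring

theorem simplePerm_liftable : M.IsLiftable cs.simplePerm := by
  classical
  intro i j
  rw [← altProd_even_eq, ← map_prod_altList, ← inv_eq_one]
  refine Equiv.ext fun ⟨t, ε⟩ => ?_
  rw [simplePerm_prod_inv_apply, wordProd_altList, altProd_even_eq, simple_mul_simple_pow,
    leftInvSeq_altList, two_mul, List.range_add, List.map_append, List.count_append,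
    List.map_map]
  -- The sequence of left inversions of `(i j)^m` repeats itself after `m` terms.
  have : (fun k => altProd (cs.simple i) (cs.simple j) (2 * k + 1)) ∘ (fun x => M i j + x) =
      fun k => altProd (cs.simple i) (cs.simple j) (2 * k + 1) := by
    funext k
    simp only [Function.comp_apply, altProd_odd_eq, pow_add, simple_mul_simple_pow, one_mul]
  rw [this]
  ext
  · simp
  · push_cast
    rw [← two_mul, (by decide : (2 : ZMod 2) = 0)]
    simp

/-- The action of `W` on `W × ℤ/2` in which `s` acts by `(t, ε) ↦ (s t s, ε + [t = s])`. -/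
noncomputable def reflectionPerm : W →* Equiv.Perm (W × ZMod 2) :=
  cs.lift ⟨cs.simplePerm, cs.simplePerm_liftable⟩

/-- The set of left inversions of `w`, defined through the action of `w⁻¹` on `W × ℤ/2`. -/
def leftInversions (w : W) : Set W := {t | ((cs.reflectionPerm w)⁻¹ (t, 0)).2 = 1}

open Classical in
theorem mem_leftInversions_wordProd (ω : List B) (t : W) :
    t ∈ cs.leftInversions (cs.wordProd ω) ↔ Odd ((cs.leftInvSeq ω).count t) := by
  have h : cs.reflectionPerm (cs.wordProd ω) = (ω.map cs.simplePerm).prod := by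
    rw [wordProd, map_list_prod, List.map_map]
    congr 1
    exact List.map_congr_left fun i _ => cs.lift_apply_simple cs.simplePerm_liftable i
  rw [leftInversions, Set.mem_ofPred_eq, h, simplePerm_prod_inv_apply]
  simp [ZMod.natCast_eq_one_iff_odd]

theorem leftInvSeq_append (ω ω' : List B) :
    cs.leftInvSeq (ω ++ ω') =
      cs.leftInvSeq ω ++ (cs.leftInvSeq ω').map (MulAut.conj (cs.wordProd ω)) := by
  induction ω with
  | nil => simp
  | cons i ω ih =>
    simp only [List.cons_append, leftInvSeq, ih, List.map_append, List.map_map, wordProd_cons,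
      map_mul]
    rfl

/-- The cocycle property of inversion sets: `inv (u v)` is the symmetric difference of `inv u` and
`u (inv v) u⁻¹`. -/
theorem mem_leftInversions_mul (u v t : W) :
    t ∈ cs.leftInversions (u * v) ↔
      ¬ (t ∈ cs.leftInversions u ↔ u⁻¹ * t * u ∈ cs.leftInversions v) := by
  classical
  obtain ⟨ω, rfl⟩ := cs.wordProd_surjective u
  obtain ⟨ω', rfl⟩ := cs.wordProd_surjective v
  rw [← wordProd_append]
  simp only [mem_leftInversions_wordProd]
  have ht : t = MulAut.conj (cs.wordProd ω) ((cs.wordProd ω)⁻¹ * t * cs.wordProd ω) := by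
    simp [mul_assoc]
  rw [leftInvSeq_append, List.count_append]
  conv_lhs =>
    rw [ht, List.count_map_of_injective _ _ (MulAut.conj (cs.wordProd ω)).injective, ← ht]
  rw [Nat.odd_add, ← Nat.not_odd_iff_even]
  tauto

theorem leftInversions_wordProd {ω : List B} (hω : cs.IsReduced ω) :
    cs.leftInversions (cs.wordProd ω) = {t | t ∈ cs.leftInvSeq ω} := by
  classical
  ext t
  rw [mem_leftInversions_wordProd, Set.mem_ofPred_eq, hω.nodup_leftInvSeq.count]
  split_ifs with h <;> simp [h]

theorem finite_leftInversions (w : W) : (cs.leftInversions w).Finite := by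
  obtain ⟨ω, hω, rfl⟩ := cs.exists_isReduced w
  rw [cs.leftInversions_wordProd hω]
  exact List.finite_toSet _

theorem ncard_leftInversions (w : W) : (cs.leftInversions w).ncard = cs.length w := by
  classical
  obtain ⟨ω, hω, rfl⟩ := cs.exists_isReduced w
  rw [cs.leftInversions_wordProd hω, hω.eq, ← cs.length_leftInvSeq ω,
    ← List.toFinset_card_of_nodup hω.nodup_leftInvSeq, ← Set.ncard_coe_finset]
  simp

theorem not_mem_leftInversions_one (t : W) : t ∉ cs.leftInversions 1 := by
  classical
  rw [← cs.wordProd_nil, mem_leftInversions_wordProd]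
  simp

theorem isReflection_of_mem_leftInversions {w t : W} (ht : t ∈ cs.leftInversions w) :
    cs.IsReflection t := by
  obtain ⟨ω, hω, rfl⟩ := cs.exists_isReduced w
  rw [cs.leftInversions_wordProd hω] at ht
  exact cs.isReflection_of_mem_leftInvSeq ω ht

theorem IsReflection.mem_leftInversions_self {t : W} (ht : cs.IsReflection t) :
    t ∈ cs.leftInversions t := by
  classical
  obtain ⟨u, i, ht⟩ := ht
  have hs : cs.simple i ∈ cs.leftInversions (cs.simple i) := by
    rw [← cs.wordProd_singleton, mem_leftInversions_wordProd]
    simp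
  have hu : u⁻¹ * t * u = cs.simple i := by rw [ht]; group
  have h1 := cs.mem_leftInversions_mul u u⁻¹ t
  rw [hu, mul_inv_cancel, iff_false_left (cs.not_mem_leftInversions_one t), not_not] at h1
  have h2 := cs.mem_leftInversions_mul u (cs.simple i * u⁻¹) t
  rw [hu, mem_leftInversions_mul (t := cs.simple i), ← mul_assoc, ← ht, inv_mul_cancel, one_mul] at h2
  rw [h2]
  tauto

/-- The strong exchange property, in the form that the elements of `leftInversions w` are the
reflections `t` with `ℓ(t w) < ℓ(w)`. -/
theorem mem_leftInversions_iff {w t : W} :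
    t ∈ cs.leftInversions w ↔ cs.IsReflection t ∧ cs.length (t * w) < cs.length w := by
  have key : ∀ w t, t ∈ cs.leftInversions w → cs.length (t * w) < cs.length w := by
    intro w t ht
    obtain ⟨ω, hω, rfl⟩ := cs.exists_isReduced w
    rw [cs.leftInversions_wordProd hω] at ht
    exact (cs.isLeftInversion_of_mem_leftInvSeq hω ht).2
  refine ⟨fun h => ⟨cs.isReflection_of_mem_leftInversions h, key w t h⟩, fun ⟨hr, hl⟩ => ?_⟩
  by_contra hw
  have h1 : t ∈ cs.leftInversions (t * w) := by
    rw [mem_leftInversions_mul, inv_mul_cancel, one_mul]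
    exact fun h => hw (h.mp hr.mem_leftInversions_self)
  have h2 := key _ _ h1
  rw [← mul_assoc, hr.mul_self, one_mul] at h2
  omega

theorem length_mul_eq_add_iff {u v : W} :
    cs.length (u * v) = cs.length u + cs.length v ↔
      ∀ t ∈ cs.leftInversions u, u⁻¹ * t * u ∉ cs.leftInversions v := by
  have hT : (MulAut.conj u '' cs.leftInversions v).ncard = cs.length v := by
    rw [Set.ncard_image_of_injective _ (MulAut.conj u).injective, ncard_leftInversions]
  have hmem : ∀ t, t ∈ MulAut.conj u '' cs.leftInversions v ↔
      u⁻¹ * t * u ∈ cs.leftInversions v := by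
    intro t
    constructor
    · rintro ⟨t, ht, rfl⟩
      simpa [mul_assoc] using ht
    · intro h
      exact ⟨_, h, by simp [mul_assoc]⟩
  have hfin := (cs.finite_leftInversions v).image (MulAut.conj u)
  constructor
  · intro hl t ht ht'
    have hsub : cs.leftInversions (u * v) ⊆
        (cs.leftInversions u ∪ MulAut.conj u '' cs.leftInversions v) \ {t} := by
      intro x hx
      rw [mem_leftInversions_mul, ← hmem] at hx
      refine ⟨?_, ?_⟩
      · rw [Set.mem_union]
        tauto
      · rintro rfl
        rw [← hmem] at ht'
        exact hx (iff_of_true ht ht')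
    have hU := (cs.finite_leftInversions u).union hfin
    have h1 := Set.ncard_le_ncard hsub (hU.subset Set.sdiff_subset)
    have h2 := Set.ncard_sdiff_singleton_lt_of_mem (Set.mem_union_left _ ht) hU
    have h3 := Set.ncard_union_le (cs.leftInversions u) (MulAut.conj u '' cs.leftInversions v)
    rw [hT, ncard_leftInversions] at h3
    rw [ncard_leftInversions] at h1
    omega
  · intro hd
    have heq : cs.leftInversions (u * v) =
        cs.leftInversions u ∪ MulAut.conj u '' cs.leftInversions v := by
      ext x
      rw [mem_leftInversions_mul, Set.mem_union, hmem]
      have := hd x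
      tauto
    have hdisj : Disjoint (cs.leftInversions u) (MulAut.conj u '' cs.leftInversions v) :=
      Set.disjoint_left.mpr fun t ht ht' => hd t ht ((hmem t).mp ht')
    rw [← ncard_leftInversions, heq,
      Set.ncard_union_eq hdisj (cs.finite_leftInversions u) hfin, hT, ncard_leftInversions]

/-! ### The weak order -/

/-- The (left prefix) weak order: `u` is a prefix of `w` if `ℓ(u) + ℓ(u⁻¹ w) = ℓ(w)`. -/
def WeakLE (u w : W) : Prop := cs.length u + cs.length (u⁻¹ * w) = cs.length w

theorem weakLE_mul_iff {u v : W} :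
    cs.WeakLE u (u * v) ↔ cs.length (u * v) = cs.length u + cs.length v := by
  rw [WeakLE, inv_mul_cancel_left, eq_comm]

theorem weakLE_refl (u : W) : cs.WeakLE u u := by simp [WeakLE]

variable {cs} in
theorem WeakLE.trans {u v w : W} (h1 : cs.WeakLE u v) (h2 : cs.WeakLE v w) : cs.WeakLE u w := by
  unfold WeakLE at *
  have h3 := cs.length_mul_le (u⁻¹ * v) (v⁻¹ * w)
  have h4 := cs.length_mul_le u (u⁻¹ * w)
  rw [show u⁻¹ * v * (v⁻¹ * w) = u⁻¹ * w by group] at h3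
  rw [mul_inv_cancel_left] at h4
  omega

theorem weakLE_iff_leftInversions_subset {u w : W} :
    cs.WeakLE u w ↔ cs.leftInversions u ⊆ cs.leftInversions w := by
  obtain ⟨v, rfl⟩ : ∃ v, w = u * v := ⟨u⁻¹ * w, by group⟩
  rw [weakLE_mul_iff, length_mul_eq_add_iff]
  refine forall₂_congr fun t ht => ?_
  rw [mem_leftInversions_mul]
  tauto

theorem simple_mem_leftInversions_iff {i : B} {w : W} :
    cs.simple i ∈ cs.leftInversions w ↔ cs.length (cs.simple i * w) < cs.length w := by
  rw [mem_leftInversions_iff, and_iff_right (cs.isReflection_simple i)]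

/-! ### Parabolic subgroups -/

/-- The standard parabolic subgroup generated by the simple reflections in `J`, as the set of
products of words with letters in `J`. -/
def parabolic (J : Set B) : Subgroup W where
  carrier := {x | ∃ ω : List B, (∀ i ∈ ω, i ∈ J) ∧ cs.wordProd ω = x}
  one_mem' := ⟨[], by simp, by simp⟩
  mul_mem' := by
    rintro _ _ ⟨ω, h, rfl⟩ ⟨ω', h', rfl⟩
    refine ⟨ω ++ ω', fun i hi => ?_, cs.wordProd_append _ _⟩
    rcases List.mem_append.mp hi with hi | hi
    exacts [h i hi, h' i hi]
  inv_mem' := by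
    rintro _ ⟨ω, h, rfl⟩
    exact ⟨ω.reverse, fun i hi => h i (List.mem_reverse.mp hi), cs.wordProd_reverse ω⟩

theorem simple_mem_parabolic {J : Set B} {i : B} (hi : i ∈ J) : cs.simple i ∈ cs.parabolic J :=
  ⟨[i], by simpa using hi, by simp⟩

theorem mem_parabolic_of_mem_leftInvSeq {J : Set B} {ω : List B} (hω : ∀ i ∈ ω, i ∈ J) {t : W}
    (ht : t ∈ cs.leftInvSeq ω) : t ∈ cs.parabolic J := by
  induction ω generalizing t with
  | nil => simp at ht
  | cons i ω ih =>
    have hi := cs.simple_mem_parabolic (hω i (by simp))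
    rw [leftInvSeq, List.mem_cons, List.mem_map] at ht
    rcases ht with rfl | ⟨t, ht, rfl⟩
    · exact hi
    · exact mul_mem (mul_mem hi (ih (fun i hi => hω i (by simp [hi])) ht)) (inv_mem hi)

theorem leftInversions_subset_parabolic {J : Set B} {x : W} (hx : x ∈ cs.parabolic J) :
    cs.leftInversions x ⊆ cs.parabolic J := by
  classical
  obtain ⟨ω, hω, rfl⟩ := hx
  intro t ht
  rw [mem_leftInversions_wordProd] at ht
  exact cs.mem_parabolic_of_mem_leftInvSeq hω (List.count_pos_iff.mp ht.pos)

theorem exists_leftDescent_of_mem_parabolic {J : Set B} {x : W} (hx : x ∈ cs.parabolic J)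
    (h1 : x ≠ 1) : ∃ i ∈ J, cs.length (cs.simple i * x) < cs.length x := by
  classical
  obtain ⟨ω, hω, rfl⟩ := hx
  induction hn : ω.length using Nat.strong_induction_on generalizing ω with
  | _ n ih =>
    cases ω with
    | nil => simp at h1
    | cons i ω =>
      by_cases hi : cs.simple i ∈ cs.leftInversions (cs.wordProd (i :: ω))
      · exact ⟨i, hω i (by simp), cs.simple_mem_leftInversions_iff.mp hi⟩
      -- Otherwise the letter `i` cancels against a later letter, and there is a shorter word.
      rw [wordProd_cons, mem_leftInversions_mul, inv_mul_cancel, one_mul] at hi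
      have hi' : cs.simple i ∈ cs.leftInversions (cs.wordProd ω) := by
        have := (cs.isReflection_simple i).mem_leftInversions_self
        tauto
      rw [mem_leftInversions_wordProd] at hi'
      obtain ⟨k, hk, hik⟩ := List.mem_iff_getElem.mp (List.count_pos_iff.mp hi'.pos)
      have heq : cs.wordProd (i :: ω) = cs.wordProd (ω.eraseIdx k) := by
        rw [wordProd_cons, ← hik, ← List.getD_eq_getElem _ 1 hk, getD_leftInvSeq_mul_wordProd]
      rw [heq] at h1 ⊢
      refine ih _ ?_ _ (fun j hj => hω j (List.mem_cons_of_mem _ (List.mem_of_mem_eraseIdx hj)))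
        h1 rfl
      rw [length_leftInvSeq] at hk
      have := List.length_eraseIdx_add_one hk
      simp only [List.length_cons] at hn
      omega

/-- If `y` is of minimal length in the coset `W_J y`, then lengths add in `W_J y`. -/
theorem length_mul_of_minimal {J : Set B} {x y : W} (hx : x ∈ cs.parabolic J)
    (hy : ∀ p ∈ cs.parabolic J, cs.length y ≤ cs.length (p * y)) :
    cs.length (x * y) = cs.length x + cs.length y := by
  rw [length_mul_eq_add_iff]
  intro t ht ht'
  have htP := cs.leftInversions_subset_parabolic hx ht
  have := (cs.mem_leftInversions_iff.mp ht').2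
  have := hy _ (mul_mem (mul_mem (inv_mem hx) htP) hx)
  omega

/-- Every element is a product `x y` with `x ∈ W_J` and `y` of minimal length in `W_J y`. -/
theorem exists_parabolic_mul_minimal (J : Set B) (v : W) :
    ∃ x ∈ cs.parabolic J, ∃ y, v = x * y ∧
      ∀ p ∈ cs.parabolic J, cs.length y ≤ cs.length (p * y) := by
  let p := Function.argmin fun p : cs.parabolic J => cs.length (p * v)
  obtain ⟨p, hp, hmin⟩ : ∃ p ∈ cs.parabolic J, ∀ q ∈ cs.parabolic J,
      cs.length (p * v) ≤ cs.length (q * v) :=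
    ⟨p, p.2, fun q hq => Function.argmin_le (fun p : cs.parabolic J => cs.length (p * v)) ⟨q, hq⟩⟩
  exact ⟨p⁻¹, inv_mem hp, p * v, by group, fun q hq => by
    rw [← mul_assoc]; exact hmin _ (mul_mem hq hp)⟩

theorem length_parabolic_mul {J : Set B} {x y : W} (hx : x ∈ cs.parabolic J)
    (hy : ∀ i ∈ J, ¬ cs.length (cs.simple i * y) < cs.length y) :
    cs.length (x * y) = cs.length x + cs.length y := by
  obtain ⟨p, hp, y', rfl, hmin⟩ := cs.exists_parabolic_mul_minimal J y
  have hp1 : p = 1 := by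
    by_contra h1
    obtain ⟨i, hi, hl⟩ := cs.exists_leftDescent_of_mem_parabolic hp h1
    apply hy i hi
    rw [← mul_assoc, cs.length_mul_of_minimal (mul_mem (cs.simple_mem_parabolic hi) hp) hmin,
      cs.length_mul_of_minimal hp hmin]
    omega
  subst hp1
  rw [one_mul]
  exact cs.length_mul_of_minimal hx hmin

theorem length_mul_parabolic {J : Set B} {x y : W} (hx : x ∈ cs.parabolic J)
    (hy : ∀ i ∈ J, ¬ cs.length (y * cs.simple i) < cs.length y) :
    cs.length (y * x) = cs.length y + cs.length x := by
  rw [← length_inv, mul_inv_rev, cs.length_parabolic_mul (inv_mem hx), length_inv, length_inv,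
    add_comm]
  intro i hi
  rw [length_inv, ← length_inv, mul_inv_rev, inv_inv, inv_simple]
  exact hy i hi

end CoxeterSystem

namespace CoxeterMatrix

theorem altProd_succ_right {G : Type*} [Monoid G] (s t : G) (k : ℕ) :
    altProd s t (k + 1) = altProd s t k * if Even k then s else t := by
  induction k generalizing s t with
  | zero => simp [altProd]
  | succ k ih =>
    change s * altProd t s (k + 1) = s * altProd t s k * _
    rw [ih, mul_assoc]
    simp only [Nat.even_add_one, ite_not]

end CoxeterMatrix

namespace CoxeterSystem

open CoxeterMatrix

variable {B W : Type*} [Group W] {M : CoxeterMatrix B} (cs : CoxeterSystem M W)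

/-! ### Dihedral parabolic subgroups and Matsumoto's theorem -/

theorem take_altList {B : Type*} (i j : B) {k n : ℕ} (h : n ≤ k) :
    (altList i j k).take n = altList i j n := by
  induction n generalizing i j k with
  | zero => rfl
  | succ n ih =>
    obtain ⟨k, rfl⟩ := Nat.exists_eq_add_of_le' (Nat.one_le_of_lt h)
    simp [altList, ih j i (show n ≤ k by omega)]

theorem altProd_simple_comm (i j : B) :
    altProd (cs.simple i) (cs.simple j) (M i j) = altProd (cs.simple j) (cs.simple i) (M i j) := by
  rw [← mul_inv_eq_one, altProd_involutions (cs.simple_mul_simple_self i)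
    (cs.simple_mul_simple_self j), cs.simple_mul_simple_pow]

theorem altProd_mem_parabolic {J : Set B} {i j : B} (hi : i ∈ J) (hj : j ∈ J) (k : ℕ) :
    altProd (cs.simple i) (cs.simple j) k ∈ cs.parabolic J := by
  induction k generalizing i j with
  | zero => exact one_mem _
  | succ k ih => exact mul_mem (cs.simple_mem_parabolic hi) (ih hj hi)

theorem le_of_isReduced_altList {i j : B} (hm : M i j ≠ 0) {k : ℕ}
    (h : cs.IsReduced (altList i j k)) : k ≤ M i j := by
  by_contra! hk
  have h1 : cs.IsReduced (altList i j (M i j + 1)) := by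
    rw [← take_altList i j hk]
    exact h.take _
  obtain ⟨n, hn⟩ := Nat.exists_eq_succ_of_ne_zero hm
  have h2 : cs.wordProd (altList i j (M i j + 1)) = cs.wordProd (altList j i n) := by
    rw [wordProd_altList, wordProd_altList]
    change cs.simple i * altProd _ _ _ = _
    rw [← altProd_simple_comm, hn]
    change cs.simple i * (cs.simple i * _) = _
    rw [simple_mul_simple_cancel_left]
  have h3 := cs.length_wordProd_le (altList j i n)
  rw [← h2, h1.eq, length_altList, length_altList] at h3
  omega

/-- If both `i` and `j` are left descents of `v`, then `M i j` is finite and the alternating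
product of length `M i j` is a prefix of `v`. -/
theorem exists_eq_altProd_mul {i j : B} (hij : i ≠ j) {v : W}
    (hi : cs.length (cs.simple i * v) < cs.length v)
    (hj : cs.length (cs.simple j * v) < cs.length v) :
    M i j ≠ 0 ∧ ∃ y, v = altProd (cs.simple i) (cs.simple j) (M i j) * y ∧
      cs.length v = M i j + cs.length y := by
  classical
  -- Take the longest alternating prefix.
  let Q : ℕ → Prop := fun k => ∃ a b, (a = i ∧ b = j ∨ a = j ∧ b = i) ∧
    ∃ y, v = altProd (cs.simple a) (cs.simple b) k * y ∧ cs.length v = k + cs.length y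
  have hQ1 : Q 1 := by
    refine ⟨i, j, Or.inl ⟨rfl, rfl⟩, cs.simple i * v, by simp [altProd], ?_⟩
    rw [← (cs.isLeftDescent_iff).mp hi, add_comm]
  have hbd : ∀ k, Q k → k ≤ cs.length v := by
    rintro k ⟨a, b, -, y, -, h⟩
    omega
  obtain ⟨k, hkQ, hkmax⟩ : ∃ k, Q k ∧ ∀ k', Q k' → k' ≤ k :=
    ⟨Nat.findGreatest Q (cs.length v), Nat.findGreatest_spec (hbd 1 hQ1) hQ1,
      fun k' hk' => Nat.le_findGreatest (hbd k' hk') hk'⟩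
  have hk1 := hkmax 1 hQ1
  obtain ⟨a, b, hab, y, hv, hl⟩ := hkQ
  have hMab : M a b = M i j := by
    rcases hab with ⟨rfl, rfl⟩ | ⟨rfl, rfl⟩
    exacts [rfl, M.symmetric _ _]
  have hab' : b ≠ a := by
    rcases hab with ⟨rfl, rfl⟩ | ⟨rfl, rfl⟩
    exacts [hij.symm, hij]
  have hbv : cs.length (cs.simple b * v) < cs.length v := by
    rcases hab with ⟨rfl, rfl⟩ | ⟨rfl, rfl⟩ <;> assumption
  obtain ⟨n, rfl⟩ := Nat.exists_eq_add_of_le' hk1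
  -- By maximality, the remaining factor has no left descent among the two letters.
  have hy : ∀ e ∈ ({a, b} : Set B), ¬ cs.length (cs.simple e * y) < cs.length y := by
    intro e he hlt
    have hlt' := (cs.isLeftDescent_iff).mp hlt
    have hcase : (e = if Even (n + 1) then a else b) ∨ (e = if Even n then a else b) := by
      rcases he with rfl | he
      · by_cases h : Even n <;> simp [h, Nat.even_add_one]
      · rw [Set.mem_singleton_iff] at he
        subst he
        by_cases h : Even n <;> simp [h, Nat.even_add_one]
    rcases hcase with he | he
    · have : Q (n + 1 + 1) := by
        refine ⟨a, b, hab, cs.simple e * y, ?_, by omega⟩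
        rw [altProd_succ_right, ← apply_ite cs.simple, ← he, mul_assoc,
          simple_mul_simple_cancel_left, hv]
      have := hkmax _ this
      omega
    · have h1 : v = altProd (cs.simple a) (cs.simple b) n * (cs.simple e * y) := by
        rw [hv, altProd_succ_right, ← apply_ite cs.simple, ← he, mul_assoc]
      have h2 := cs.length_mul_le (altProd (cs.simple a) (cs.simple b) n) (cs.simple e * y)
      have h3 := cs.length_wordProd_le (altList a b n)
      rw [wordProd_altList, length_altList] at h3
      rw [← h1] at h2
      omega
  have hxP := cs.altProd_mem_parabolic (J := {a, b}) (Set.mem_insert a _)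
    (Set.mem_insert_of_mem _ rfl) (n + 1)
  have hbP := cs.simple_mem_parabolic (J := {a, b}) (Set.mem_insert_of_mem _ rfl : b ∈ _)
  have hlx := cs.length_parabolic_mul hxP hy
  have hred : cs.IsReduced (altList a b (n + 1)) := by
    rw [IsReduced, wordProd_altList, length_altList]
    rw [← hv] at hlx
    omega
  -- As `b` is a descent, it is one of the reflections `(a b)^r a`.
  have hbx : cs.simple b ∈ cs.leftInversions (cs.wordProd (altList a b (n + 1))) := by
    rw [simple_mem_leftInversions_iff, wordProd_altList]
    have h1 := cs.length_parabolic_mul (mul_mem hbP hxP) hy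
    rw [mul_assoc, ← hv] at h1
    rw [← hv] at hlx
    omega
  rw [cs.leftInversions_wordProd hred, leftInvSeq_altList, Set.mem_ofPred_eq, List.mem_map] at hbx
  obtain ⟨r, hr, hrb⟩ := hbx
  have hpow : (cs.simple b * cs.simple a) ^ (r + 1) = 1 := by
    rw [← altProd_even_eq]
    change cs.simple b * altProd (cs.simple a) (cs.simple b) (2 * r + 1) = 1
    rw [hrb, simple_mul_simple_self]
  have hdvd := cs.dvd_of_simple_mul_simple_pow_eq_one hab' hpow
  rw [M.symmetric, hMab] at hdvd
  have hm0 : M i j ≠ 0 := by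
    intro h0
    rw [h0, zero_dvd_iff] at hdvd
    omega
  have hle := Nat.le_of_dvd (by omega) hdvd
  have hle' := cs.le_of_isReduced_altList (by rwa [hMab]) hred
  have hkm : n + 1 = M i j := by
    have := List.mem_range.mp hr
    omega
  refine ⟨hm0, y, ?_, by omega⟩
  rw [hkm] at hv
  rcases hab with ⟨rfl, rfl⟩ | ⟨rfl, rfl⟩
  · exact hv
  · rwa [altProd_simple_comm]

/-- Matsumoto's theorem: a map to a monoid that satisfies the braid relations takes the same value
on all reduced words of an element. -/
theorem prod_map_eq_of_isReduced {N : Type*} [Monoid N] {f : B → N}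
    (hf : ∀ i j, altProd (f i) (f j) (M i j) = altProd (f j) (f i) (M i j))
    {ω ω' : List B} (hω : cs.IsReduced ω) (hω' : cs.IsReduced ω')
    (h : cs.wordProd ω = cs.wordProd ω') : (ω.map f).prod = (ω'.map f).prod := by
  induction hn : ω.length using Nat.strong_induction_on generalizing ω ω' with
  | _ n ih =>
    have hlen : ω.length = ω'.length := by rw [← hω.eq, h, hω'.eq]
    -- The case of equal first letters.
    have same : ∀ (i : B) (τ τ' : List B), τ.length + 1 = n → cs.IsReduced (i :: τ) →
        cs.IsReduced (i :: τ') → cs.wordProd (i :: τ) = cs.wordProd (i :: τ') →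
        ((i :: τ).map f).prod = ((i :: τ').map f).prod := by
      intro i τ τ' hl h1 h2 h3
      rw [List.map_cons, List.map_cons, List.prod_cons, List.prod_cons]
      rw [wordProd_cons, wordProd_cons, mul_right_inj] at h3
      exact congrArg (f i * ·) (ih τ.length (by omega) (h1.drop 1) (h2.drop 1) h3 rfl)
    cases ω with
    | nil =>
      have : ω' = [] := List.eq_nil_of_length_eq_zero (by simpa using hlen.symm)
      rw [this]
    | cons i τ =>
      cases ω' with
      | nil => simp at hlen
      | cons j τ' =>
        by_cases hij : i = j
        · subst hij
          exact same i τ τ' (by simpa using hn) hω hω' h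
        have desc : ∀ (k : B) (σ : List B), cs.IsReduced (k :: σ) →
            cs.length (cs.simple k * cs.wordProd (k :: σ)) < cs.length (cs.wordProd (k :: σ)) := by
          intro k σ hσ
          rw [hσ.eq, wordProd_cons, simple_mul_simple_cancel_left]
          have := cs.length_wordProd_le σ
          simp only [List.length_cons]
          omega
        have di := desc i τ hω
        have dj := desc j τ' hω'
        rw [← h] at dj
        obtain ⟨hm, y, hy, hly⟩ := cs.exists_eq_altProd_mul hij di dj
        obtain ⟨ν, hν, rfl⟩ := cs.exists_isReduced y
        have hvlen : cs.length (cs.wordProd (i :: τ)) = n := by rw [hω.eq, hn]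
        obtain ⟨m, hm'⟩ := Nat.exists_eq_succ_of_ne_zero hm
        have e1 : cs.wordProd (i :: τ) = cs.wordProd (i :: (altList j i m ++ ν)) := by
          rw [show i :: (altList j i m ++ ν) = altList i j (M i j) ++ ν by rw [hm']; rfl,
            wordProd_append, wordProd_altList]
          exact hy
        have e2 : cs.wordProd (j :: τ') = cs.wordProd (j :: (altList i j m ++ ν)) := by
          rw [show j :: (altList i j m ++ ν) = altList j i (M i j) ++ ν by rw [hm']; rfl,
            wordProd_append, wordProd_altList, ← altProd_simple_comm, ← h]
          exact hy
        have r1 : cs.IsReduced (i :: (altList j i m ++ ν)) := by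
          rw [IsReduced, ← e1, hly, hν.eq]
          simp only [List.length_cons, List.length_append, length_altList]
          omega
        have r2 : cs.IsReduced (j :: (altList i j m ++ ν)) := by
          rw [IsReduced, ← e2, ← h, hly, hν.eq]
          simp only [List.length_cons, List.length_append, length_altList]
          omega
        rw [same i τ _ (by simpa using hn) hω r1 e1,
          same j τ' _ (by simpa [hn] using hlen.symm) hω' r2 e2]
        rw [show i :: (altList j i m ++ ν) = altList i j (M i j) ++ ν by rw [hm']; rfl,
          show j :: (altList i j m ++ ν) = altList j i (M i j) ++ ν by rw [hm']; rfl,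
          List.map_append, List.map_append, List.prod_append, List.prod_append,
          map_prod_altList, map_prod_altList, hf]

/-! ### Greatest elements in the weak order -/

variable {cs} in
theorem WeakLE.length_le {u w : W} (h : cs.WeakLE u w) : cs.length u ≤ cs.length w := by
  unfold WeakLE at h
  omega

variable {cs} in
theorem WeakLE.antisymm {u w : W} (h : cs.WeakLE u w) (h' : cs.WeakLE w u) : u = w := by
  have h1 := h.length_le
  have h2 := h'.length_le
  unfold WeakLE at h
  have : cs.length (u⁻¹ * w) = 0 := by omega
  rw [length_eq_zero_iff, inv_mul_eq_one] at this
  exact this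

theorem one_weakLE (w : W) : cs.WeakLE 1 w := by simp [WeakLE]

/-- Newman's lemma for the weak order: a bounded set, closed under prefixes, in which two upper
covers of the same element have an upper bound, has a greatest element. -/
theorem exists_greatest_of_confluent (D : W → Prop) (N : ℕ) (hN : ∀ d, D d → cs.length d ≤ N)
    (h1 : D 1) (hdown : ∀ d e, D e → cs.WeakLE d e → D d)
    (hconf : ∀ d i j, D (d * cs.simple i) → D (d * cs.simple j) →
      cs.WeakLE d (d * cs.simple i) → cs.WeakLE d (d * cs.simple j) →
      ∃ e, D e ∧ cs.WeakLE (d * cs.simple i) e ∧ cs.WeakLE (d * cs.simple j) e) :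
    ∃ m, D m ∧ ∀ x, D x → cs.WeakLE x m := by
  -- Every proper multiple of `d` is a multiple of an upper cover of `d`.
  have cover : ∀ d x, cs.WeakLE d x → d = x ∨
      ∃ i, cs.WeakLE d (d * cs.simple i) ∧ cs.WeakLE (d * cs.simple i) x := by
    intro d x hdx
    by_cases hne : d⁻¹ * x = 1
    · exact Or.inl (inv_mul_eq_one.mp hne)
    obtain ⟨i, hi⟩ := cs.exists_leftDescent_of_ne_one hne
    rw [isLeftDescent_iff] at hi
    refine Or.inr ⟨i, ?_⟩
    have a1 := cs.length_mul_le d (cs.simple i)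
    have a2 := cs.length_mul_le (d * cs.simple i) (cs.simple i * (d⁻¹ * x))
    have a3 : d * cs.simple i * (cs.simple i * (d⁻¹ * x)) = x := by simp [mul_assoc]
    have a4 : (d * cs.simple i)⁻¹ * x = cs.simple i * (d⁻¹ * x) := by simp [mul_assoc]
    rw [length_simple] at a1
    rw [a3] at a2
    unfold WeakLE at *
    rw [inv_mul_cancel_left, length_simple, a4]
    omega
  have main : ∀ n d, D d → N - cs.length d = n →
      ∃ m, D m ∧ cs.WeakLE d m ∧ ∀ x, D x → cs.WeakLE d x → cs.WeakLE x m := by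
    intro n
    induction n using Nat.strong_induction_on with
    | _ n ih =>
      intro d hd hn
      have step : ∀ i, cs.WeakLE d (d * cs.simple i) → D (d * cs.simple i) →
          ∃ m, D m ∧ cs.WeakLE (d * cs.simple i) m ∧
            ∀ x, D x → cs.WeakLE (d * cs.simple i) x → cs.WeakLE x m := by
        intro i hi hDi
        have := hN _ hDi
        rw [weakLE_mul_iff, length_simple] at hi
        exact ih _ (by omega) _ hDi rfl
      by_cases hex : ∃ i, cs.WeakLE d (d * cs.simple i) ∧ D (d * cs.simple i)
      · obtain ⟨i, hi, hDi⟩ := hex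
        obtain ⟨m, hm, him, hmax⟩ := step i hi hDi
        refine ⟨m, hm, hi.trans him, fun x hx hdx => ?_⟩
        rcases cover d x hdx with rfl | ⟨j, hj, hjx⟩
        · exact hi.trans him
        · have hDj := hdown _ _ hx hjx
          obtain ⟨e, he, hie, hje⟩ := hconf d i j hDi hDj hi hj
          obtain ⟨m', hm', hjm', hmax'⟩ := step j hj hDj
          have hmm' : cs.WeakLE m' m := hmax m' hm' (hie.trans (hmax' e he hje))
          exact (hmax' x hx hjx).trans hmm'
      · refine ⟨d, hd, cs.weakLE_refl d, fun x hx hdx => ?_⟩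
        rcases cover d x hdx with rfl | ⟨j, hj, hjx⟩
        · exact hdx
        · exact absurd ⟨j, hj, hdown _ _ hx hjx⟩ hex
  obtain ⟨m, hm, -, hmax⟩ := main _ 1 h1 rfl
  exact ⟨m, hm, fun x hx => hmax x hx (cs.one_weakLE x)⟩

/-- Among the prefixes `u` of `v` for which the product `w u` is reduced there is a greatest one. -/
theorem exists_greatest_reduced_prefix (w v : W) :
    ∃ m, (cs.WeakLE m v ∧ cs.length (w * m) = cs.length w + cs.length m) ∧
      ∀ x, (cs.WeakLE x v ∧ cs.length (w * x) = cs.length w + cs.length x) → cs.WeakLE x m := by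
  apply cs.exists_greatest_of_confluent _ (cs.length v)
  · exact fun d hd => hd.1.length_le
  · exact ⟨cs.one_weakLE v, by simp⟩
  · rintro d e ⟨he, hwe⟩ hde
    refine ⟨hde.trans he, ?_⟩
    have h1 := cs.length_mul_le (w * d) (d⁻¹ * e)
    have h2 := cs.length_mul_le w d
    rw [show w * d * (d⁻¹ * e) = w * e by group] at h1
    unfold WeakLE at hde
    omega
  · rintro d i j ⟨hiv, hiw⟩ ⟨hjv, hjw⟩ hi hj
    rw [weakLE_mul_iff, length_simple] at hi hj
    obtain ⟨x, hx, y, hxy, hmin⟩ := cs.exists_parabolic_mul_minimal {i, j} (d⁻¹ * v)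
    have hadd := cs.length_mul_of_minimal hx hmin
    have hdv : cs.length d + cs.length (d⁻¹ * v) = cs.length v := by
      have : cs.WeakLE d (d * cs.simple i) := by rwa [weakLE_mul_iff, length_simple]
      exact this.trans hiv
    -- Both letters are left descents of the parabolic part `x` of `d⁻¹ v`.
    have hdesc : ∀ k ∈ ({i, j} : Set B), cs.WeakLE (d * cs.simple k) v →
        cs.length (d * cs.simple k) = cs.length d + 1 →
        cs.length (cs.simple k * x) + 1 = cs.length x := by
      intro k hk hkv hkd
      have a1 : (d * cs.simple k)⁻¹ * v = cs.simple k * (d⁻¹ * v) := by simp [mul_assoc]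
      have a2 := cs.length_mul_of_minimal (mul_mem (cs.simple_mem_parabolic hk) hx) hmin
      rw [mul_assoc, ← hxy] at a2
      rw [← hxy] at hadd
      unfold WeakLE at hkv
      rw [a1] at hkv
      have a3 := cs.length_simple_mul x k
      omega
    have hdi := hdesc i (Set.mem_insert _ _) hiv hi
    have hdj := hdesc j (Set.mem_insert_of_mem _ rfl) hjv hj
    have hdx : cs.length (d * x) = cs.length d + cs.length x := by
      have a1 := cs.length_mul_le d x
      have a2 := cs.length_mul_le (d * x) y
      rw [show d * x * y = v by rw [mul_assoc, ← hxy]; group] at a2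
      rw [hxy] at hdv
      omega
    have hwd : cs.length (w * d) = cs.length w + cs.length d := by
      have a1 := cs.length_mul_le (w * d) (cs.simple i)
      have a2 := cs.length_mul_le w d
      rw [length_simple, mul_assoc] at a1
      omega
    have hwdx : cs.length (w * d * x) = cs.length (w * d) + cs.length x := by
      apply cs.length_mul_parabolic hx
      rintro k (rfl | hk)
      · rw [mul_assoc]
        omega
      · rw [Set.mem_singleton_iff] at hk
        subst hk
        rw [mul_assoc]
        omega
    refine ⟨d * x, ⟨?_, ?_⟩, ?_, ?_⟩
    · unfold WeakLE
      rw [show (d * x)⁻¹ * v = y by rw [mul_inv_rev, mul_assoc, hxy]; group]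
      rw [hxy] at hdv
      omega
    · rw [← mul_assoc]
      omega
    · unfold WeakLE
      rw [show (d * cs.simple i)⁻¹ * (d * x) = cs.simple i * x by simp [mul_assoc]]
      omega
    · unfold WeakLE
      rw [show (d * cs.simple j)⁻¹ * (d * x) = cs.simple j * x by simp [mul_assoc]]
      omega

end CoxeterSystem

namespace CoxeterSystem

open CoxeterMatrix

variable {B W : Type*} [Group W] {M : CoxeterMatrix B} (cs : CoxeterSystem M W)

/-! ### The longest element and joins in the weak order -/

/-- `w₀` is a longest element. -/
def IsLongest (w₀ : W) : Prop := ∀ w, cs.length w ≤ cs.length w₀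

variable {cs} {w₀ : W}

theorem IsLongest.mem_leftInversions_iff (h : cs.IsLongest w₀) {t : W} :
    t ∈ cs.leftInversions w₀ ↔ cs.IsReflection t := by
  rw [cs.mem_leftInversions_iff]
  exact and_iff_left_of_imp fun ht => lt_of_le_of_ne (h _) (ht.length_mul_right_ne w₀)

theorem IsLongest.weakLE (h : cs.IsLongest w₀) (w : W) : cs.WeakLE w w₀ := by
  rw [weakLE_iff_leftInversions_subset]
  exact fun t ht => h.mem_leftInversions_iff.mpr (cs.isReflection_of_mem_leftInversions ht)

theorem IsLongest.length_mul_left (h : cs.IsLongest w₀) (w : W) :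
    cs.length w + cs.length (w⁻¹ * w₀) = cs.length w₀ := h.weakLE w

theorem IsLongest.mul_self (h : cs.IsLongest w₀) : w₀ * w₀ = 1 := by
  have := h.length_mul_left w₀⁻¹
  rw [inv_inv, length_inv] at this
  rw [← cs.length_eq_zero_iff]
  omega

theorem IsLongest.length_mul_right (h : cs.IsLongest w₀) (w : W) :
    cs.length (w₀ * w) + cs.length w = cs.length w₀ := by
  have h1 := h.length_mul_left w
  have h2 : w⁻¹ * w₀ = (w₀ * w)⁻¹ := by
    rw [mul_inv_rev, inv_eq_of_mul_eq_one_left h.mul_self]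
  rw [h2, length_inv] at h1
  omega

theorem mem_leftInversions_inv {w t : W} :
    t ∈ cs.leftInversions w⁻¹ ↔ w * t * w⁻¹ ∈ cs.leftInversions w := by
  have h1 := cs.mem_leftInversions_mul w⁻¹ w t
  rw [inv_mul_cancel, iff_false_left (cs.not_mem_leftInversions_one t), not_not, inv_inv] at h1
  exact h1

theorem IsLongest.mem_leftInversions_mul (h : cs.IsLongest w₀) {u t : W} :
    t ∈ cs.leftInversions (u * w₀) ↔ cs.IsReflection t ∧ t ∉ cs.leftInversions u := by
  rw [cs.mem_leftInversions_mul, h.mem_leftInversions_iff]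
  have h1 : cs.IsReflection (u⁻¹ * t * u) ↔ cs.IsReflection t := by
    simpa using cs.isReflection_conj_iff u⁻¹ t
  have h2 := fun ht => cs.isReflection_of_mem_leftInversions (w := u) (t := t) ht
  rw [h1]
  tauto

theorem IsLongest.mul_weakLE_mul (h : cs.IsLongest w₀) {u v : W} :
    cs.WeakLE (u * w₀) (v * w₀) ↔ cs.WeakLE v u := by
  rw [weakLE_iff_leftInversions_subset, weakLE_iff_leftInversions_subset]
  simp only [Set.subset_def, h.mem_leftInversions_mul]
  have := fun t => cs.isReflection_of_mem_leftInversions (w := v) (t := t)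
  constructor
  · intro H t ht
    by_contra hu
    exact (H t ⟨this t ht, hu⟩).2 ht
  · exact fun H t ht => ⟨ht.1, fun hv => ht.2 (H t hv)⟩

/-- A product `w x` is reduced if and only if `x` is a prefix of the complement `w⁻¹ w₀`. -/
theorem IsLongest.length_mul_eq_add_iff (h : cs.IsLongest w₀) {w x : W} :
    cs.length (w * x) = cs.length w + cs.length x ↔ cs.WeakLE x (w⁻¹ * w₀) := by
  rw [cs.length_mul_eq_add_iff, weakLE_iff_leftInversions_subset]
  simp only [Set.subset_def, h.mem_leftInversions_mul, mem_leftInversions_inv]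
  constructor
  · intro H t ht
    refine ⟨cs.isReflection_of_mem_leftInversions ht, fun h' => H _ h' ?_⟩
    rwa [show w⁻¹ * (w * t * w⁻¹) * w = t by group]
  · intro H t ht ht'
    apply (H _ ht').2
    rwa [show w * (w⁻¹ * t * w) * w⁻¹ = t by group]

/-- Joins exist in the weak order of a finite Coxeter group: `u ↦ u w₀` reverses the order, and the
meet of `a` and `b` is the greatest prefix `x` of `a` for which `w₀ b⁻¹ x` is reduced. -/
theorem IsLongest.exists_join (h : cs.IsLongest w₀) (u v : W) :
    ∃ j, cs.WeakLE u j ∧ cs.WeakLE v j ∧ ∀ c, cs.WeakLE u c → cs.WeakLE v c → cs.WeakLE j c := by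
  obtain ⟨m, ⟨hm1, hm2⟩, hm3⟩ :=
    cs.exists_greatest_reduced_prefix (w₀ * (v * w₀)⁻¹) (u * w₀)
  simp only [h.length_mul_eq_add_iff, mul_inv_rev, inv_inv, inv_mul_cancel_right] at hm2 hm3
  have hmw : m = m * w₀ * w₀ := by rw [mul_assoc, h.mul_self, mul_one]
  refine ⟨m * w₀, ?_, ?_, fun c hu hv => ?_⟩
  · rwa [← h.mul_weakLE_mul, ← hmw]
  · rwa [← h.mul_weakLE_mul, ← hmw]
  · rw [← h.mul_weakLE_mul, ← hmw]
    exact hm3 _ ⟨h.mul_weakLE_mul.mpr hu, h.mul_weakLE_mul.mpr hv⟩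

theorem IsLongest.length_conj_simple (h : cs.IsLongest w₀) (i : B) :
    ∃ j, w₀ * cs.simple i * w₀ = cs.simple j := by
  rw [← length_eq_one_iff]
  have h1 := h.length_mul_left (w₀ * cs.simple i)⁻¹
  have h2 := h.length_mul_right (cs.simple i)
  rw [inv_inv, length_inv] at h1
  rw [length_simple] at h2
  omega

theorem IsLongest.isReduced_altList (h : cs.IsLongest w₀) {i j : B} (hij : i ≠ j) :
    cs.IsReduced (altList i j (M i j)) := by
  have desc : ∀ k, cs.length (cs.simple k * w₀) < cs.length w₀ := fun k =>
    lt_of_le_of_ne (h _) (cs.length_simple_mul_ne w₀ k)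
  obtain ⟨-, y, hy, hl⟩ := cs.exists_eq_altProd_mul hij (desc i) (desc j)
  have h1 := cs.length_mul_le (altProd (cs.simple i) (cs.simple j) (M i j)) y
  have h2 := cs.length_wordProd_le (altList i j (M i j))
  rw [← hy] at h1
  rw [IsReduced, wordProd_altList, length_altList] at *
  omega

end CoxeterSystem

/-! ### The braid monoid and its atoms -/

namespace CoxeterMatrix

variable {B : Type*} (M : CoxeterMatrix B)

/-- The braid monoid: the monoid with generators `B` and the Artin relations. -/
abbrev BraidMonoid : Type _ :=
  PresentedMonoid fun a b : FreeMonoid B => ∃ i j,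
    a = altProd (FreeMonoid.of i) (FreeMonoid.of j) (M i j) ∧
      b = altProd (FreeMonoid.of j) (FreeMonoid.of i) (M i j)

/-- The standard generators of the braid monoid. -/
def braidGen (i : B) : M.BraidMonoid := PresentedMonoid.of _ i

theorem altProd_braidGen (i j : B) :
    altProd (M.braidGen i) (M.braidGen j) (M i j) =
      altProd (M.braidGen j) (M.braidGen i) (M i j) := by
  have h := PresentedMonoid.mk_eq_mk_of_rel (rels := fun a b : FreeMonoid B => ∃ i j,
    a = altProd (FreeMonoid.of i) (FreeMonoid.of j) (M i j) ∧
      b = altProd (FreeMonoid.of j) (FreeMonoid.of i) (M i j)) ⟨i, j, rfl, rfl⟩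
  rwa [map_altProd, map_altProd] at h

variable {M} in
theorem braidMonoid_induction {p : M.BraidMonoid → Prop} (one : p 1)
    (gen_mul : ∀ i b, p b → p (M.braidGen i * b)) (b : M.BraidMonoid) : p b := by
  obtain ⟨a, rfl⟩ := PresentedMonoid.surjective_mk b
  induction a using FreeMonoid.inductionOn' with
  | one => exact one
  | of_mul i a ih => exact gen_mul i _ ih

/-- The homomorphism from the braid monoid given by a map on generators that satisfies the braid
relations. -/
def braidLift {N : Type*} [Monoid N] (f : B → N)
    (hf : ∀ i j, altProd (f i) (f j) (M i j) = altProd (f j) (f i) (M i j)) :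
    M.BraidMonoid →* N :=
  PresentedMonoid.lift f (by
    rintro _ _ ⟨i, j, rfl, rfl⟩
    simpa only [map_altProd, FreeMonoid.lift_eval_of] using hf i j)

end CoxeterMatrix

namespace CoxeterSystem

open CoxeterMatrix

variable {B W : Type*} [Group W] {M : CoxeterMatrix B} (cs : CoxeterSystem M W)

/-- The canonical lift of `w` to the braid monoid: the product of any reduced word of `w`. -/
noncomputable def braidAtom (w : W) : M.BraidMonoid :=
  ((cs.exists_isReduced w).choose.map M.braidGen).prod

theorem braidAtom_wordProd {ω : List B} (hω : cs.IsReduced ω) :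
    cs.braidAtom (cs.wordProd ω) = (ω.map M.braidGen).prod := by
  have h := (cs.exists_isReduced (cs.wordProd ω)).choose_spec
  exact cs.prod_map_eq_of_isReduced M.altProd_braidGen h.1 hω h.2.symm

theorem braidAtom_mul {u v : W} (h : cs.length (u * v) = cs.length u + cs.length v) :
    cs.braidAtom (u * v) = cs.braidAtom u * cs.braidAtom v := by
  obtain ⟨ω, hω, rfl⟩ := cs.exists_isReduced u
  obtain ⟨ω', hω', rfl⟩ := cs.exists_isReduced v
  rw [hω.eq, hω'.eq, ← wordProd_append] at h
  rw [← wordProd_append, braidAtom_wordProd, braidAtom_wordProd cs hω, braidAtom_wordProd cs hω',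
    List.map_append, List.prod_append]
  rw [IsReduced, h, List.length_append]

theorem braidAtom_one : cs.braidAtom 1 = 1 := by
  rw [← cs.wordProd_nil, braidAtom_wordProd _ (by simp [IsReduced])]
  rfl

theorem braidAtom_simple (i : B) : cs.braidAtom (cs.simple i) = M.braidGen i := by
  rw [← cs.wordProd_singleton, braidAtom_wordProd _ (by simp [IsReduced])]
  simp

theorem braidAtom_mul_of_weakLE {u v : W} (h : cs.WeakLE u v) :
    cs.braidAtom u * cs.braidAtom (u⁻¹ * v) = cs.braidAtom v := by
  rw [← braidAtom_mul, mul_inv_cancel_left]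
  rw [mul_inv_cancel_left]
  exact h.symm

/-- The greatest prefix `x` of `v` such that `w x` is reduced. -/
noncomputable def maxAbsorb (w v : W) : W := (cs.exists_greatest_reduced_prefix w v).choose

theorem maxAbsorb_weakLE (w v : W) : cs.WeakLE (cs.maxAbsorb w v) v :=
  (cs.exists_greatest_reduced_prefix w v).choose_spec.1.1

theorem length_mul_maxAbsorb (w v : W) :
    cs.length (w * cs.maxAbsorb w v) = cs.length w + cs.length (cs.maxAbsorb w v) :=
  (cs.exists_greatest_reduced_prefix w v).choose_spec.1.2

theorem weakLE_maxAbsorb {w v x : W} (h1 : cs.WeakLE x v)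
    (h2 : cs.length (w * x) = cs.length w + cs.length x) : cs.WeakLE x (cs.maxAbsorb w v) :=
  (cs.exists_greatest_reduced_prefix w v).choose_spec.2 x ⟨h1, h2⟩

theorem weakLE_mul_left_iff {w x y : W} (hx : cs.length (w * x) = cs.length w + cs.length x)
    (hy : cs.length (w * y) = cs.length w + cs.length y) :
    cs.WeakLE (w * x) (w * y) ↔ cs.WeakLE x y := by
  unfold WeakLE
  rw [show (w * x)⁻¹ * (w * y) = x⁻¹ * y by group]
  omega

theorem maxAbsorb_mul {u w : W} (h : cs.length (u * w) = cs.length u + cs.length w) (v : W) :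
    cs.maxAbsorb u (w * cs.maxAbsorb w v) = w * cs.maxAbsorb (u * w) v := by
  have hx0 := cs.length_mul_maxAbsorb w v
  have hx0v := cs.maxAbsorb_weakLE w v
  set x₀ := cs.maxAbsorb w v with hx0_def
  have hx := cs.length_mul_maxAbsorb (u * w) v
  have hxv := cs.maxAbsorb_weakLE (u * w) v
  set x := cs.maxAbsorb (u * w) v with hx_def
  have hy := cs.length_mul_maxAbsorb u (w * x₀)
  have hyw := cs.maxAbsorb_weakLE u (w * x₀)
  have hwy : cs.WeakLE w (cs.maxAbsorb u (w * x₀)) :=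
    cs.weakLE_maxAbsorb (cs.weakLE_mul_iff.mpr hx0) h
  obtain ⟨z, hz⟩ : ∃ z, cs.maxAbsorb u (w * x₀) = w * z := ⟨w⁻¹ * cs.maxAbsorb u (w * x₀), by group⟩
  have hmax : ∀ y, cs.WeakLE y (w * x₀) → cs.length (u * y) = cs.length u + cs.length y →
      cs.WeakLE y (w * z) := fun y h1 h2 => hz ▸ cs.weakLE_maxAbsorb h1 h2
  rw [hz] at hy hyw hwy ⊢
  rw [weakLE_mul_iff] at hwy
  rw [cs.weakLE_mul_left_iff hwy hx0] at hyw
  have hwx : cs.length (w * x) = cs.length w + cs.length x := by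
    have h1 := cs.length_mul_le u (w * x)
    have h2 := cs.length_mul_le w x
    rw [mul_assoc] at hx
    omega
  have hzx : cs.WeakLE z x := cs.weakLE_maxAbsorb (hyw.trans hx0v) (by rw [mul_assoc]; omega)
  have hxx0 : cs.WeakLE x x₀ := cs.weakLE_maxAbsorb hxv hwx
  have hxz : cs.WeakLE x z := by
    rw [← cs.weakLE_mul_left_iff hwx hwy]
    exact hmax _ ((cs.weakLE_mul_left_iff hwx hx0).mpr hxx0) (by rw [← mul_assoc]; omega)
  rw [hzx.antisymm hxz]

/-- Left multiplication by the atom of `w` on normal forms: the pair `(v, b)` stands for the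
product of the atom of `v` and `b`, and the first factor of the product of `w` with it absorbs as
much of `v` as possible. -/
noncomputable def absorb (w : W) : Function.End (W × M.BraidMonoid) := fun p =>
  (w * cs.maxAbsorb w p.1, cs.braidAtom ((cs.maxAbsorb w p.1)⁻¹ * p.1) * p.2)

theorem absorb_mul {u w : W} (h : cs.length (u * w) = cs.length u + cs.length w) :
    cs.absorb (u * w) = cs.absorb u * cs.absorb w := by
  funext ⟨v, b⟩
  have hu := cs.maxAbsorb_mul h v
  have hxx0 : cs.WeakLE (cs.maxAbsorb (u * w) v) (cs.maxAbsorb w v) := by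
    refine cs.weakLE_maxAbsorb (cs.maxAbsorb_weakLE _ _) ?_
    have h1 := cs.length_mul_le u (w * cs.maxAbsorb (u * w) v)
    have h2 := cs.length_mul_le w (cs.maxAbsorb (u * w) v)
    have h3 := cs.length_mul_maxAbsorb (u * w) v
    rw [mul_assoc] at h3
    omega
  have hx0v := cs.maxAbsorb_weakLE w v
  change (_, _) = (u * cs.maxAbsorb u (w * cs.maxAbsorb w v),
    cs.braidAtom ((cs.maxAbsorb u (w * cs.maxAbsorb w v))⁻¹ * (w * cs.maxAbsorb w v)) *
      (cs.braidAtom ((cs.maxAbsorb w v)⁻¹ * v) * b))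
  rw [hu, ← mul_assoc (cs.braidAtom _), ← braidAtom_mul]
  · rw [mul_assoc u w]
    congr 3
    group
  · have h4 := hxx0.trans hx0v
    unfold WeakLE at hxx0 hx0v h4
    rw [show (w * cs.maxAbsorb (u * w) v)⁻¹ * (w * cs.maxAbsorb w v) * ((cs.maxAbsorb w v)⁻¹ * v) =
      (cs.maxAbsorb (u * w) v)⁻¹ * v by group,
      show (w * cs.maxAbsorb (u * w) v)⁻¹ * (w * cs.maxAbsorb w v) =
      (cs.maxAbsorb (u * w) v)⁻¹ * cs.maxAbsorb w v by group]
    omega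

theorem absorb_one : cs.absorb 1 = 1 := by
  funext ⟨v, b⟩
  have h : cs.maxAbsorb 1 v = v :=
    (cs.maxAbsorb_weakLE 1 v).antisymm (cs.weakLE_maxAbsorb (cs.weakLE_refl v) (by simp))
  change (_, _) = (v, b)
  simp [h, braidAtom_one]

theorem absorb_wordProd {ω : List B} (hω : cs.IsReduced ω) :
    cs.absorb (cs.wordProd ω) = (ω.map fun i => cs.absorb (cs.simple i)).prod := by
  induction ω with
  | nil => exact cs.absorb_one
  | cons i ω ih =>
    have h : cs.IsReduced ω := hω.drop 1
    rw [List.map_cons, List.prod_cons, ← ih h, wordProd_cons, absorb_mul]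
    rw [← wordProd_cons, hω.eq, h.eq, length_simple, List.length_cons, add_comm]

theorem braidAtom_absorb (w v : W) (b : M.BraidMonoid) :
    cs.braidAtom (cs.absorb w (v, b)).1 * (cs.absorb w (v, b)).2 =
      cs.braidAtom w * (cs.braidAtom v * b) := by
  change cs.braidAtom (w * cs.maxAbsorb w v) *
    (cs.braidAtom ((cs.maxAbsorb w v)⁻¹ * v) * b) = _
  rw [braidAtom_mul _ (cs.length_mul_maxAbsorb w v),
    ← cs.braidAtom_mul_of_weakLE (cs.maxAbsorb_weakLE w v)]
  simp only [mul_assoc]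

variable {cs} {w₀ : W}

/-- The action of the braid monoid on the pairs `(v, b)`. -/
noncomputable def IsLongest.absorbHom (h : cs.IsLongest w₀) :
    M.BraidMonoid →* Function.End (W × M.BraidMonoid) :=
  M.braidLift (fun i => cs.absorb (cs.simple i)) (by
    intro i j
    by_cases hij : i = j
    · rw [hij]
    · rw [← map_prod_altList (fun i => cs.absorb (cs.simple i)),
        ← map_prod_altList (fun i => cs.absorb (cs.simple i)),
        ← cs.absorb_wordProd (h.isReduced_altList hij),
        ← cs.absorb_wordProd (by rw [M.symmetric]; exact h.isReduced_altList (Ne.symm hij)),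
        wordProd_altList, wordProd_altList, altProd_simple_comm])

theorem IsLongest.absorbHom_braidAtom (h : cs.IsLongest w₀) (w : W) :
    h.absorbHom (cs.braidAtom w) = cs.absorb w := by
  obtain ⟨ω, hω, rfl⟩ := cs.exists_isReduced w
  rw [cs.braidAtom_wordProd hω, map_list_prod, cs.absorb_wordProd hω, List.map_map]
  rfl

/-- The splitting `b = α(b) ω(b)` of an element of the braid monoid: the first component is the
image in `W` of its greatest atom prefix, the second one is the remaining factor. -/
noncomputable def IsLongest.split (h : cs.IsLongest w₀) (b : M.BraidMonoid) : W × M.BraidMonoid :=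
  h.absorbHom b (1, 1)

theorem IsLongest.split_braidAtom_mul (h : cs.IsLongest w₀) (w : W) (b : M.BraidMonoid) :
    h.split (cs.braidAtom w * b) = cs.absorb w (h.split b) := by
  rw [split, map_mul, absorbHom_braidAtom]
  rfl

theorem IsLongest.split_eq (h : cs.IsLongest w₀) (b : M.BraidMonoid) :
    cs.braidAtom (h.split b).1 * (h.split b).2 = b := by
  induction b using braidMonoid_induction with
  | one =>
    change cs.braidAtom 1 * 1 = 1
    rw [braidAtom_one, mul_one]
  | gen_mul i b ih =>
    rw [← cs.braidAtom_simple, split_braidAtom_mul]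
    conv_rhs => rw [← ih]
    exact cs.braidAtom_absorb _ _ _

theorem IsLongest.braidAtom_dvd_iff (h : cs.IsLongest w₀) {w : W} {b : M.BraidMonoid} :
    cs.braidAtom w ∣ b ↔ cs.WeakLE w (h.split b).1 := by
  constructor
  · rintro ⟨c, rfl⟩
    rw [split_braidAtom_mul]
    exact cs.weakLE_mul_iff.mpr (cs.length_mul_maxAbsorb _ _)
  · intro hw
    refine ⟨cs.braidAtom (w⁻¹ * (h.split b).1) * (h.split b).2, ?_⟩
    rw [← mul_assoc, cs.braidAtom_mul_of_weakLE hw, h.split_eq]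

/-! ### Cancellation and least common multiples in the braid monoid -/

/-- A generator can be cancelled on the left: `b` can be read off from the splitting of `s b`, whose
first factor is `s x` with `x` a prefix of the first factor of `b`. -/
theorem IsLongest.braidGen_mul_cancel (h : cs.IsLongest w₀) {i : B} {b c : M.BraidMonoid}
    (hbc : M.braidGen i * b = M.braidGen i * c) : b = c := by
  have key : ∀ b : M.BraidMonoid, cs.braidAtom (cs.simple i * (h.split (M.braidGen i * b)).1) *
      (h.split (M.braidGen i * b)).2 = b := by
    intro b
    rw [← cs.braidAtom_simple, split_braidAtom_mul]
    change cs.braidAtom (cs.simple i * (cs.simple i * cs.maxAbsorb (cs.simple i) (h.split b).1)) *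
      (cs.braidAtom ((cs.maxAbsorb (cs.simple i) (h.split b).1)⁻¹ * (h.split b).1) *
        (h.split b).2) = b
    rw [simple_mul_simple_cancel_left, ← mul_assoc,
      cs.braidAtom_mul_of_weakLE (cs.maxAbsorb_weakLE _ _), h.split_eq]
  rw [← key b, hbc, key c]

theorem IsLongest.mul_left_cancel (h : cs.IsLongest w₀) {a b c : M.BraidMonoid}
    (habc : a * b = a * c) : b = c := by
  induction a using braidMonoid_induction generalizing b c with
  | one => simpa using habc
  | gen_mul i a ih =>
    rw [mul_assoc, mul_assoc] at habc
    exact ih (h.braidGen_mul_cancel habc)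

theorem IsLongest.mul_dvd_mul_iff (h : cs.IsLongest w₀) {a b c : M.BraidMonoid} :
    a * b ∣ a * c ↔ b ∣ c := by
  refine ⟨fun ⟨d, hd⟩ => ⟨d, h.mul_left_cancel (a := a) ?_⟩, fun ⟨d, hd⟩ => ⟨d, ?_⟩⟩
  · rw [hd, mul_assoc]
  · rw [hd, mul_assoc]

/-- `m` is a least common right multiple of `a` and `b`. -/
def IsLcm {N : Type*} [Monoid N] (a b m : N) : Prop := a ∣ m ∧ b ∣ m ∧ ∀ c, a ∣ c → b ∣ c → m ∣ c

theorem IsLcm.symm {N : Type*} [Monoid N] {a b m : N} (h : IsLcm a b m) : IsLcm b a m :=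
  ⟨h.2.1, h.1, fun c h1 h2 => h.2.2 c h2 h1⟩

theorem IsLongest.isLcm_mul (h : cs.IsLongest w₀) {a a' b g m : M.BraidMonoid}
    (h1 : IsLcm a g (g * a')) (h2 : IsLcm a' b m) : IsLcm a (g * b) (g * m) := by
  refine ⟨h1.1.trans (h.mul_dvd_mul_iff.mpr h2.1), h.mul_dvd_mul_iff.mpr h2.2.1, ?_⟩
  rintro _ ha ⟨c, rfl⟩
  rw [mul_assoc] at ha ⊢
  have h3 := h1.2.2 _ ha (Dvd.intro _ rfl)
  rw [h.mul_dvd_mul_iff] at h3 ⊢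
  exact h2.2.2 _ h3 (Dvd.intro _ rfl)

theorem IsLongest.exists_isLcm_braidAtom (h : cs.IsLongest w₀) (u : W) (b : M.BraidMonoid) :
    ∃ m, IsLcm (cs.braidAtom u) b m := by
  induction b using braidMonoid_induction generalizing u with
  | one => exact ⟨_, dvd_rfl, one_dvd _, fun c hc _ => hc⟩
  | gen_mul i b ih =>
    obtain ⟨j, hu, hi, hj⟩ := h.exists_join u (cs.simple i)
    have hlcm : IsLcm (cs.braidAtom u) (M.braidGen i)
        (M.braidGen i * cs.braidAtom ((cs.simple i)⁻¹ * j)) := by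
      rw [← cs.braidAtom_simple, cs.braidAtom_mul_of_weakLE hi]
      refine ⟨Dvd.intro _ (cs.braidAtom_mul_of_weakLE hu),
        Dvd.intro _ (cs.braidAtom_mul_of_weakLE hi), fun c h1 h2 => ?_⟩
      rw [h.braidAtom_dvd_iff] at h1 h2 ⊢
      exact hj _ h1 h2
    obtain ⟨m, hm⟩ := ih ((cs.simple i)⁻¹ * j)
    exact ⟨_, h.isLcm_mul hlcm hm⟩

theorem IsLongest.exists_isLcm (h : cs.IsLongest w₀) (a b : M.BraidMonoid) :
    ∃ m, IsLcm a b m := by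
  induction a using braidMonoid_induction generalizing b with
  | one => exact ⟨b, one_dvd _, dvd_rfl, fun c _ hc => hc⟩
  | gen_mul i a ih =>
    obtain ⟨m, hm⟩ := h.exists_isLcm_braidAtom (cs.simple i) b
    rw [cs.braidAtom_simple] at hm
    obtain ⟨b', rfl⟩ := hm.1
    obtain ⟨m', hm'⟩ := ih b'
    exact ⟨_, (h.isLcm_mul hm.symm hm'.symm).symm⟩

/-! ### The Garside element and the embedding into the Artin group -/

theorem IsLongest.braidAtom_mul_braidGen (h : cs.IsLongest w₀) {i j : B}
    (hij : w₀ * cs.simple i * w₀ = cs.simple j) :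
    cs.braidAtom w₀ * M.braidGen i = M.braidGen j * cs.braidAtom w₀ := by
  have hj : (cs.simple j)⁻¹ * w₀ = w₀ * cs.simple i := by
    rw [inv_simple, ← hij, mul_assoc, h.mul_self, mul_one]
  have h1 : M.braidGen j * cs.braidAtom (w₀ * cs.simple i) = cs.braidAtom w₀ := by
    rw [← hj, ← cs.braidAtom_simple, cs.braidAtom_mul_of_weakLE (h.weakLE _)]
  have h2 : cs.braidAtom (w₀ * cs.simple i) * M.braidGen i = cs.braidAtom w₀ := by
    rw [← cs.braidAtom_simple, ← braidAtom_mul, simple_mul_simple_cancel_right]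
    rw [simple_mul_simple_cancel_right]
    have := h.length_mul_right (cs.simple i)
    omega
  conv_lhs => rw [← h1, mul_assoc, h2]

theorem IsLongest.commute_sq (h : cs.IsLongest w₀) (b : M.BraidMonoid) :
    Commute (cs.braidAtom w₀ ^ 2) b := by
  induction b using braidMonoid_induction with
  | one => exact Commute.one_right _
  | gen_mul i b ih =>
    refine Commute.mul_right ?_ ih
    obtain ⟨j, hj⟩ := h.length_conj_simple i
    have hi : w₀ * cs.simple j * w₀ = cs.simple i := by
      rw [← hj]
      simp only [mul_assoc]
      rw [h.mul_self, mul_one, ← mul_assoc, h.mul_self, one_mul]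
    rw [Commute, SemiconjBy, pow_two, mul_assoc, h.braidAtom_mul_braidGen hj, ← mul_assoc,
      h.braidAtom_mul_braidGen hi, mul_assoc]

theorem IsLongest.exists_mul_eq_pow (h : cs.IsLongest w₀) (b : M.BraidMonoid) :
    ∃ n c, b * c = (cs.braidAtom w₀ ^ 2) ^ n := by
  induction b using braidMonoid_induction with
  | one => exact ⟨0, 1, by simp⟩
  | gen_mul i b ih =>
    obtain ⟨n, c, hc⟩ := ih
    refine ⟨n + 1, c * (cs.braidAtom ((cs.simple i)⁻¹ * w₀) * cs.braidAtom w₀), ?_⟩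
    rw [mul_assoc, ← mul_assoc b, hc, ((h.commute_sq _).pow_left n).eq, ← mul_assoc, ← mul_assoc,
      ← cs.braidAtom_simple, cs.braidAtom_mul_of_weakLE (h.weakLE _), pow_succ' _ n, pow_two]

theorem IsLongest.exists_mul_eq_pow' (h : cs.IsLongest w₀) (b : M.BraidMonoid) :
    ∃ n c, c * b = (cs.braidAtom w₀ ^ 2) ^ n := by
  obtain ⟨n, c, hc⟩ := h.exists_mul_eq_pow b
  refine ⟨n, c, h.mul_left_cancel (a := b) ?_⟩
  rw [← mul_assoc, hc, ((h.commute_sq _).pow_left n).eq]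

theorem IsLongest.mul_right_cancel (h : cs.IsLongest w₀) {a b c : M.BraidMonoid}
    (habc : a * c = b * c) : a = b := by
  obtain ⟨n, d, hd⟩ := h.exists_mul_eq_pow c
  have : (cs.braidAtom w₀ ^ 2) ^ n * a = (cs.braidAtom w₀ ^ 2) ^ n * b := by
    rw [((h.commute_sq _).pow_left n).eq, ((h.commute_sq _).pow_left n).eq, ← hd, ← mul_assoc,
      habc, mul_assoc]
  exact h.mul_left_cancel this

/-- The braid monoid of finite type satisfies the Ore condition: left fractions exist because every
element divides a power of the central element `Δ²`. -/
@[reducible] noncomputable def IsLongest.oreSet (h : cs.IsLongest w₀) :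
    OreLocalization.OreSet (⊤ : Submonoid M.BraidMonoid) where
  ore_right_cancel r₁ r₂ s hs := ⟨1, by rw [h.mul_right_cancel hs]⟩
  oreNum r s := r * (h.exists_mul_eq_pow' s).choose_spec.choose
  oreDenom r s := ⟨(cs.braidAtom w₀ ^ 2) ^ (h.exists_mul_eq_pow' s).choose, trivial⟩
  ore_eq r s := by
    rw [mul_assoc, (h.exists_mul_eq_pow' s).choose_spec.choose_spec,
      ((h.commute_sq r).pow_left _).eq]

end CoxeterSystem

namespace CoxeterMatrix

variable {B : Type*} (M : CoxeterMatrix B)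

theorem altProd_artinGen (i j : B) :
    altProd (M.artinGen i) (M.artinGen j) (M i j) =
      altProd (M.artinGen j) (M.artinGen i) (M i j) := by
  have h : (PresentedGroup.mk M.artinRelations) (altProd (FreeGroup.of i) (FreeGroup.of j) (M i j) *
      (altProd (FreeGroup.of j) (FreeGroup.of i) (M i j))⁻¹) = 1 :=
    PresentedGroup.one_of_mem ⟨(i, j), rfl⟩
  rw [map_mul, map_inv, mul_inv_eq_one, map_altProd, map_altProd] at h
  exact h

/-- The natural homomorphism from the braid monoid to the Artin group. -/
def braidToArtin : M.BraidMonoid →* M.ArtinGroup :=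
  M.braidLift M.artinGen M.altProd_artinGen

theorem braidToArtin_braidGen (i : B) : M.braidToArtin (M.braidGen i) = M.artinGen i := rfl

/-- For finite type the braid monoid embeds into the Artin group, because it embeds into its group
of fractions, to which the Artin group maps. -/
theorem braidToArtin_injective [Finite M.Group] : Function.Injective M.braidToArtin := by
  obtain ⟨w₀, h⟩ : ∃ w₀, M.toCoxeterSystem.IsLongest w₀ :=
    Finite.exists_max M.toCoxeterSystem.length
  let _ := h.oreSet
  let φ : M.BraidMonoid →* (OreLocalization (⊤ : Submonoid M.BraidMonoid) M.BraidMonoid) :=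
    OreLocalization.numeratorHom
  let g : B → (OreLocalization (⊤ : Submonoid M.BraidMonoid) M.BraidMonoid)ˣ := fun i =>
    OreLocalization.numeratorUnit ⟨M.braidGen i, trivial⟩
  have hg : ∀ i j, altProd (g i) (g j) (M i j) = altProd (g j) (g i) (M i j) := by
    intro i j
    have e : ∀ i j k, ((altProd (g i) (g j) k : Units _) : OreLocalization _ M.BraidMonoid) =
        φ (altProd (M.braidGen i) (M.braidGen j) k) := by
      intro i j k
      rw [map_altProd]
      exact map_altProd (Units.coeHom _) (g i) (g j) k
    rw [Units.ext_iff, e, e, altProd_braidGen]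
  let ψ : M.ArtinGroup →* (OreLocalization (⊤ : Submonoid M.BraidMonoid) M.BraidMonoid)ˣ :=
    PresentedGroup.toGroup (f := g) (by
      rintro _ ⟨⟨i, j⟩, rfl⟩
      rw [map_mul, map_inv, mul_inv_eq_one, map_altProd, map_altProd]
      simpa using hg i j)
  have hψ : ∀ b, ((ψ (M.braidToArtin b) : Units _) : OreLocalization _ M.BraidMonoid) = φ b := by
    intro b
    induction b using braidMonoid_induction with
    | one => simp
    | gen_mul i b ih =>
      rw [map_mul, map_mul, Units.val_mul, ih, map_mul, braidToArtin_braidGen]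
      congr 1
      exact congrArg Units.val (PresentedGroup.toGroup.of _)
  intro a b hab
  have h1 : φ a = φ b := by rw [← hψ, hab, hψ]
  change OreLocalization.oreDiv a 1 = OreLocalization.oreDiv b 1 at h1
  rw [OreLocalization.oreDiv_eq_iff] at h1
  obtain ⟨u, v, h1, h2⟩ := h1
  simp only [OneMemClass.coe_one, mul_one] at h2
  change (u : M.BraidMonoid) * b = v * a at h1
  change (u : M.BraidMonoid) = v at h2
  rw [h2] at h1
  exact (h.mul_left_cancel h1).symm

end CoxeterMatrix

namespace CoxeterMatrix

variable {B : Type*} (M : CoxeterMatrix B)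

/-! ### The lattice order of the Artin group -/

theorem artinLength_artinGen (i : B) :
    Multiplicative.toAdd (M.artinLength (M.artinGen i)) = 1 :=
  congrArg Multiplicative.toAdd (PresentedGroup.toGroup.of _)

theorem braidToArtin_map_prod (ω : List B) :
    M.braidToArtin (ω.map M.braidGen).prod = (ω.map M.artinGen).prod := by
  rw [map_list_prod, List.map_map]
  rfl

theorem exists_word_of_mem_artinPos {a : M.ArtinGroup} (ha : a ∈ M.artinPos) :
    ∃ ω : List B, a = (ω.map M.artinGen).prod := by
  induction ha using Submonoid.closure_induction with
  | mem x hx =>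
    obtain ⟨i, rfl⟩ := hx
    exact ⟨[i], by simp⟩
  | one => exact ⟨[], rfl⟩
  | mul x y _ _ hx hy =>
    obtain ⟨ω, rfl⟩ := hx
    obtain ⟨ω', rfl⟩ := hy
    exact ⟨ω ++ ω', by simp⟩

theorem artinGen_mem_artinPos (i : B) : M.artinGen i ∈ M.artinPos :=
  Submonoid.subset_closure ⟨i, rfl⟩

theorem mem_artinPos_iff {a : M.ArtinGroup} : a ∈ M.artinPos ↔ ∃ b, M.braidToArtin b = a := by
  constructor
  · intro ha
    obtain ⟨ω, rfl⟩ := M.exists_word_of_mem_artinPos ha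
    exact ⟨_, M.braidToArtin_map_prod ω⟩
  · rintro ⟨b, rfl⟩
    induction b using braidMonoid_induction with
    | one => simp
    | gen_mul i b ih =>
      rw [map_mul]
      exact mul_mem (M.artinGen_mem_artinPos i) ih

theorem artinLength_word (ω : List B) :
    Multiplicative.toAdd (M.artinLength (ω.map M.artinGen).prod) = ω.length := by
  induction ω with
  | nil => simp
  | cons i ω ih =>
    simp only [List.map_cons, List.prod_cons, map_mul, toAdd_mul, ih, artinLength_artinGen,
      List.length_cons]
    omega

theorem artinToCoxeter_word (ω : List B) :
    M.artinToCoxeter (ω.map M.artinGen).prod = M.toCoxeterSystem.wordProd ω := by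
  rw [map_list_prod, List.map_map, CoxeterSystem.wordProd]
  rfl

theorem length_artinToCoxeter_le {a : M.ArtinGroup} (ha : a ∈ M.artinPos) :
    (M.toCoxeterSystem.length (M.artinToCoxeter a) : ℤ) ≤
      Multiplicative.toAdd (M.artinLength a) := by
  obtain ⟨ω, rfl⟩ := M.exists_word_of_mem_artinPos ha
  rw [artinToCoxeter_word, artinLength_word]
  exact_mod_cast M.toCoxeterSystem.length_wordProd_le ω

theorem artinLength_nonneg {a : M.ArtinGroup} (ha : a ∈ M.artinPos) :
    0 ≤ Multiplicative.toAdd (M.artinLength a) :=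
  le_trans (by positivity) (M.length_artinToCoxeter_le ha)

/-- Every atom is the canonical lift of its image in the Coxeter group. -/
theorem IsAtomElt.eq_braidToArtin {M : CoxeterMatrix B} {a : M.ArtinGroup} (ha : M.IsAtomElt a) :
    a = M.braidToArtin (M.toCoxeterSystem.braidAtom (M.artinToCoxeter a)) := by
  obtain ⟨hpos, hl⟩ := ha
  obtain ⟨ω, rfl⟩ := M.exists_word_of_mem_artinPos hpos
  rw [artinToCoxeter_word, artinLength_word] at *
  rw [CoxeterSystem.braidAtom_wordProd, braidToArtin_map_prod]
  exact_mod_cast hl.symm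

theorem finite_setOf_isAtomElt [Finite M.Group] : {a | M.IsAtomElt a}.Finite :=
  (Set.finite_range fun w => M.braidToArtin (M.toCoxeterSystem.braidAtom w)).subset
    fun _ ha => ⟨_, ha.eq_braidToArtin.symm⟩

theorem isPrefix_iff {x y : M.ArtinGroup} : M.IsPrefix x y ↔ x⁻¹ * y ∈ M.artinPos := by
  constructor
  · rintro ⟨z, hz, rfl⟩
    rwa [inv_mul_cancel_left]
  · exact fun h => ⟨_, h, by rw [mul_inv_cancel_left]⟩

theorem isPrefix_refl (x : M.ArtinGroup) : M.IsPrefix x x := ⟨1, one_mem _, by simp⟩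

variable {M} in
theorem IsPrefix.trans {x y z : M.ArtinGroup} (h1 : M.IsPrefix x y) (h2 : M.IsPrefix y z) :
    M.IsPrefix x z := by
  obtain ⟨a, ha, rfl⟩ := h1
  obtain ⟨b, hb, rfl⟩ := h2
  exact ⟨a * b, mul_mem ha hb, mul_assoc _ _ _⟩

theorem isPrefix_mul_left_iff (g : M.ArtinGroup) {x y : M.ArtinGroup} :
    M.IsPrefix (g * x) (g * y) ↔ M.IsPrefix x y := by
  rw [isPrefix_iff, isPrefix_iff, mul_inv_rev, mul_assoc, inv_mul_cancel_left]

theorem braidToArtin_isPrefix_iff [Finite M.Group] {a b : M.BraidMonoid} :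
    M.IsPrefix (M.braidToArtin a) (M.braidToArtin b) ↔ a ∣ b := by
  constructor
  · rintro ⟨z, hz, h⟩
    obtain ⟨c, rfl⟩ := M.mem_artinPos_iff.mp hz
    rw [← map_mul] at h
    exact ⟨c, M.braidToArtin_injective h⟩
  · rintro ⟨c, rfl⟩
    exact ⟨_, M.mem_artinPos_iff.mpr ⟨c, rfl⟩, map_mul _ _ _⟩

/-- An atom is its own greatest atom prefix. -/
theorem IsAtomElt.isMaxAtom {M : CoxeterMatrix B} {a : M.ArtinGroup} (ha : M.IsAtomElt a) :
    M.IsMaxAtom a a := ⟨ha, M.isPrefix_refl a, fun _ _ h => h⟩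

variable [Finite M.Group]

theorem isAtomElt_artinDelta : M.IsAtomElt M.artinDelta := M.exists_atom_longest.choose_spec.1

theorem isLongest_artinDelta : M.toCoxeterSystem.IsLongest (M.artinToCoxeter M.artinDelta) :=
  M.exists_atom_longest.choose_spec.2

theorem artinDelta_sq_commute (g : M.ArtinGroup) : Commute (M.artinDelta ^ 2) g := by
  have h : ∀ i, Commute (M.artinDelta ^ 2) (M.artinGen i) := by
    intro i
    rw [M.isAtomElt_artinDelta.eq_braidToArtin, ← map_pow, ← braidToArtin_braidGen]
    exact (M.isLongest_artinDelta.commute_sq _).map _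
  induction g using PresentedGroup.induction_on with | _ z
  induction z using FreeGroup.induction_on with
  | C1 => rw [map_one]; exact Commute.one_right _
  | of i => exact h i
  | inv_of i _ => rw [map_inv]; exact (h i).inv_right
  | mul x y hx hy => rw [map_mul]; exact hx.mul_right hy

/-- Conjugation by `Δ` permutes the standard generators, hence preserves positivity. -/
theorem artinDelta_conj_mem_artinPos {a : M.ArtinGroup} (ha : a ∈ M.artinPos) :
    M.artinDelta * a * M.artinDelta⁻¹ ∈ M.artinPos := by
  induction ha using Submonoid.closure_induction with
  | mem x hx =>
    obtain ⟨i, rfl⟩ := hx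
    obtain ⟨j, hj⟩ := M.isLongest_artinDelta.length_conj_simple i
    have h := congrArg M.braidToArtin (M.isLongest_artinDelta.braidAtom_mul_braidGen hj)
    rw [map_mul, map_mul, ← M.isAtomElt_artinDelta.eq_braidToArtin, braidToArtin_braidGen,
      braidToArtin_braidGen] at h
    rw [h, mul_inv_cancel_right]
    exact M.artinGen_mem_artinPos j
  | one => simp
  | mul x y _ _ hx hy =>
    have := mul_mem hx hy
    rwa [show M.artinDelta * x * M.artinDelta⁻¹ * (M.artinDelta * y * M.artinDelta⁻¹) =
      M.artinDelta * (x * y) * M.artinDelta⁻¹ by group] at this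

theorem artinDelta_inv_conj_mem_artinPos {a : M.ArtinGroup} (ha : a ∈ M.artinPos) :
    M.artinDelta⁻¹ * a * M.artinDelta ∈ M.artinPos := by
  have h := M.artinDelta_conj_mem_artinPos ha
  have hc := (M.artinDelta_sq_commute a).eq
  rw [pow_two] at hc
  rwa [show M.artinDelta⁻¹ * a * M.artinDelta =
      M.artinDelta⁻¹ * (a * (M.artinDelta * M.artinDelta)) * M.artinDelta⁻¹ by group, ← hc,
    show M.artinDelta⁻¹ * (M.artinDelta * M.artinDelta * a) * M.artinDelta⁻¹ =
      M.artinDelta * a * M.artinDelta⁻¹ by group]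

theorem artinDelta_zpow_conj_mem_artinPos (k : ℤ) {a : M.ArtinGroup} (ha : a ∈ M.artinPos) :
    M.artinDelta ^ k * a * (M.artinDelta ^ k)⁻¹ ∈ M.artinPos := by
  induction k with
  | zero => simpa using ha
  | succ k ih =>
    have := M.artinDelta_conj_mem_artinPos ih
    convert this using 1
    group
  | pred k ih =>
    have := M.artinDelta_inv_conj_mem_artinPos ih
    convert this using 1
    group

theorem isPrefix_mul_zpow_iff (k : ℤ) {x y : M.ArtinGroup} :
    M.IsPrefix (x * M.artinDelta ^ k) (y * M.artinDelta ^ k) ↔ M.IsPrefix x y := by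
  have key : ∀ (k : ℤ) (x y : M.ArtinGroup), M.IsPrefix x y →
      M.IsPrefix (x * M.artinDelta ^ k) (y * M.artinDelta ^ k) := by
    intro k x y h
    rw [isPrefix_iff] at *
    convert M.artinDelta_zpow_conj_mem_artinPos (-k) h using 1
    group
  refine ⟨fun h => ?_, key k x y⟩
  simpa [mul_assoc] using key (-k) _ _ h

theorem isPrefix_mul_zpow_of_le (x : M.ArtinGroup) {k l : ℤ} (h : k ≤ l) :
    M.IsPrefix (x * M.artinDelta ^ k) (x * M.artinDelta ^ l) := by
  rw [isPrefix_mul_left_iff, isPrefix_iff, ← zpow_neg, ← zpow_add]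
  obtain ⟨n, hn⟩ := Int.eq_ofNat_of_zero_le (show 0 ≤ -k + l by omega)
  rw [hn, zpow_natCast]
  exact pow_mem M.isAtomElt_artinDelta.1 n

/-- The positive prefixes of `Δ` are atoms. -/
theorem isAtomElt_of_isPrefix_artinDelta {a : M.ArtinGroup} (ha : a ∈ M.artinPos)
    (h : M.IsPrefix a M.artinDelta) : M.IsAtomElt a := by
  obtain ⟨z, hz, hz'⟩ := h
  have h1 := M.length_artinToCoxeter_le ha
  have h2 := M.length_artinToCoxeter_le hz
  have h3 := M.isAtomElt_artinDelta.2
  have h4 := M.toCoxeterSystem.length_mul_le (M.artinToCoxeter a) (M.artinToCoxeter z)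
  rw [hz', map_mul, toAdd_mul, map_mul] at h3
  exact ⟨ha, by omega⟩

/-- Every element of the Artin group becomes positive after multiplication by a power of the central
element `Δ²`. -/
theorem exists_pow_mul_mem_artinPos (g : M.ArtinGroup) :
    ∃ n : ℕ, (M.artinDelta ^ 2) ^ n * g ∈ M.artinPos := by
  have hinv : ∀ a ∈ M.artinPos, ∃ n : ℕ, (M.artinDelta ^ 2) ^ n * a⁻¹ ∈ M.artinPos := by
    intro a ha
    obtain ⟨b, rfl⟩ := M.mem_artinPos_iff.mp ha
    obtain ⟨n, c, hc⟩ := M.isLongest_artinDelta.exists_mul_eq_pow' b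
    have h := congrArg M.braidToArtin hc
    rw [map_mul, map_pow, map_pow, ← M.isAtomElt_artinDelta.eq_braidToArtin] at h
    exact ⟨n, by rw [← h, mul_inv_cancel_right]; exact M.mem_artinPos_iff.mpr ⟨c, rfl⟩⟩
  induction g using PresentedGroup.induction_on with | _ z
  induction z using FreeGroup.induction_on with
  | C1 => exact ⟨0, by simp⟩
  | of i => exact ⟨0, by rw [pow_zero, one_mul]; exact M.artinGen_mem_artinPos i⟩
  | inv_of i _ => rw [map_inv]; exact hinv _ (M.artinGen_mem_artinPos i)
  | mul x y hx hy =>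
    obtain ⟨n, hn⟩ := hx
    obtain ⟨m, hm⟩ := hy
    refine ⟨n + m, ?_⟩
    rw [map_mul]
    have := mul_mem hn hm
    rwa [mul_assoc, ← mul_assoc _ (_ ^ m), ← ((M.artinDelta_sq_commute _).pow_left m).eq,
      mul_assoc, ← mul_assoc, ← pow_add] at this

/-- Joins exist in the Artin group: they are translates of least common multiples. -/
theorem exists_join (x y : M.ArtinGroup) :
    ∃ j, ∀ c, M.IsPrefix j c ↔ M.IsPrefix x c ∧ M.IsPrefix y c := by
  obtain ⟨n, hn⟩ := M.exists_pow_mul_mem_artinPos x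
  obtain ⟨m, hm⟩ := M.exists_pow_mul_mem_artinPos y
  set z := (M.artinDelta ^ 2) ^ (n + m) with hz
  have hpos : ∀ k, (M.artinDelta ^ 2) ^ k ∈ M.artinPos := fun k =>
    pow_mem (pow_mem M.isAtomElt_artinDelta.1 2) k
  have hx : z * x ∈ M.artinPos := by
    rw [hz, add_comm, pow_add, mul_assoc]
    exact mul_mem (hpos m) hn
  have hy : z * y ∈ M.artinPos := by
    rw [hz, pow_add, mul_assoc]
    exact mul_mem (hpos n) hm
  obtain ⟨a, ha⟩ := M.mem_artinPos_iff.mp hx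
  obtain ⟨b, hb⟩ := M.mem_artinPos_iff.mp hy
  obtain ⟨l, hal, hbl, hl⟩ := M.isLongest_artinDelta.exists_isLcm a b
  refine ⟨z⁻¹ * M.braidToArtin l, fun c => ?_⟩
  have hzl : z * (z⁻¹ * M.braidToArtin l) = M.braidToArtin l := mul_inv_cancel_left _ _
  rw [← M.isPrefix_mul_left_iff z, ← M.isPrefix_mul_left_iff z (x := x),
    ← M.isPrefix_mul_left_iff z (x := y), hzl, ← ha, ← hb]
  constructor
  · exact fun h => ⟨(M.braidToArtin_isPrefix_iff.mpr hal).trans h,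
      (M.braidToArtin_isPrefix_iff.mpr hbl).trans h⟩
  · rintro ⟨h1, h2⟩
    have hc : z * c ∈ M.artinPos := by
      obtain ⟨d, hd, hd'⟩ := h1
      rw [hd']
      exact mul_mem (M.mem_artinPos_iff.mpr ⟨a, rfl⟩) hd
    obtain ⟨d, hd⟩ := M.mem_artinPos_iff.mp hc
    rw [← hd, braidToArtin_isPrefix_iff] at h1 h2 ⊢
    exact hl d h1 h2

theorem exists_finset_join {s : Finset M.ArtinGroup} (hs : s.Nonempty) :
    ∃ j, ∀ c, M.IsPrefix j c ↔ ∀ x ∈ s, M.IsPrefix x c := by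
  classical
  induction hs using Finset.Nonempty.cons_induction with
  | singleton a => exact ⟨a, fun c => by simp⟩
  | cons a s _ _ ih =>
    obtain ⟨j, hj⟩ := ih
    obtain ⟨k, hk⟩ := M.exists_join a j
    exact ⟨k, fun c => by rw [hk, hj]; simp⟩

end CoxeterMatrix

namespace CoxeterMatrix

variable {B : Type*} (M : CoxeterMatrix B) [Finite M.Group]

/-! ### Adjacent vertices -/

theorem exists_eq_artinDelta_sq_zpow {g : M.ArtinGroup} (hg : (g : M.ArtinQuot) = 1) :
    ∃ k : ℤ, g = (M.artinDelta ^ 2) ^ k := by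
  rw [QuotientGroup.eq_one_iff] at hg
  have hn : (Subgroup.zpowers (M.artinDelta ^ 2)).Normal := ⟨fun x hx g => by
    obtain ⟨k, rfl⟩ := hx
    exact ⟨k, by simp only; rw [← ((M.artinDelta_sq_commute g).zpow_left k).eq,
      mul_inv_cancel_right]⟩⟩
  have := Subgroup.normalClosure_le_normal (N := Subgroup.zpowers (M.artinDelta ^ 2))
    (Set.singleton_subset_iff.mpr (Subgroup.mem_zpowers _)) hg
  obtain ⟨k, hk⟩ := this
  exact ⟨k, hk.symm⟩

theorem smul_toVertex (u g : M.ArtinGroup) :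
    (u : M.ArtinQuot) • M.toVertex g = M.toVertex (u * g) := rfl

theorem toVertex_mul_zpow (g : M.ArtinGroup) (k : ℤ) :
    M.toVertex (g * M.artinDelta ^ k) = M.toVertex g := by
  apply QuotientGroup.eq.mpr
  refine ⟨-k, ?_⟩
  simp only [← QuotientGroup.mk_zpow, ← QuotientGroup.mk_inv, ← QuotientGroup.mk_mul]
  congr 1
  group

theorem exists_eq_zpow_of_smul_baseVertex {g : M.ArtinQuot}
    (h : g • M.baseVertex = M.baseVertex) : ∃ k : ℤ, g = (M.artinDelta : M.ArtinQuot) ^ k := by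
  obtain ⟨u, rfl⟩ := QuotientGroup.mk_surjective g
  rw [baseVertex, smul_toVertex, mul_one] at h
  obtain ⟨k, hk⟩ := QuotientGroup.eq.mp h.symm
  refine ⟨k, ?_⟩
  change (M.artinDelta : M.ArtinQuot) ^ k = _ at hk
  rw [hk]
  simp

/-- A vertex `a *`, different from `*`, with `a` a positive prefix of `Δ` has atomnorm `1`: the
one-term list `[a]` is a normal form. -/
theorem atomNorm_toVertex_eq_one {a : M.ArtinGroup} (ha : a ∈ M.artinPos)
    (hD : M.IsPrefix a M.artinDelta) (hne : M.toVertex a ≠ M.baseVertex) :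
    M.atomNorm (M.toVertex a) = 1 := by
  have hat := M.isAtomElt_of_isPrefix_artinDelta ha hD
  have ha1 : a ≠ 1 := by rintro rfl; exact hne rfl
  have haD : M.artinDelta ≠ a := by
    rintro rfl
    apply hne
    have := M.toVertex_mul_zpow 1 1
    rwa [one_mul, zpow_one] at this
  have hnf : M.IsNormalForm [a] := by
    refine ⟨fun b hb => ?_, fun b L' hL => ?_⟩
    · rw [List.mem_singleton] at hb
      exact hb ▸ ⟨hat, ha1⟩
    · obtain ⟨rfl, rfl⟩ : b = a ∧ L' = [] := by simpa using hL.sublist.eq_of_length_le (by simp)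
      simpa using hat.isMaxAtom
  have h1 : 1 ∈ {n | ∃ L : List M.ArtinGroup,
      M.IsNormalForm L ∧ M.artinDelta ∉ L ∧ M.toVertex L.prod = M.toVertex a ∧ L.length = n} :=
    ⟨[a], hnf, by simpa using haD, by simp, rfl⟩
  have hle : M.atomNorm (M.toVertex a) ≤ 1 := Nat.sInf_le h1
  have h0 : M.atomNorm (M.toVertex a) ≠ 0 := by
    intro h0
    obtain ⟨L, -, -, hL, hlen⟩ := Nat.sInf_mem ⟨1, h1⟩
    change _ = M.atomNorm (M.toVertex a) at hlen
    rw [h0, List.length_eq_zero_iff] at hlen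
    subst hlen
    exact hne hL.symm
  omega

theorem atomDist_baseVertex_eq_one {a : M.ArtinGroup} (ha : a ∈ M.artinPos)
    (hD : M.IsPrefix a M.artinDelta) (hne : M.toVertex a ≠ M.baseVertex) :
    M.atomDist M.baseVertex (M.toVertex a) = 1 := by
  have hset : {n | ∃ g : M.ArtinQuot, g • M.baseVertex = M.baseVertex ∧
      M.atomNorm (g⁻¹ • M.toVertex a) = n} = {1} := by
    -- An element of the stabiliser `⟨Δ⟩` of `*` conjugates `a` to another positive prefix of `Δ`.
    have hnorm : ∀ g : M.ArtinQuot, g • M.baseVertex = M.baseVertex →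
        M.atomNorm (g⁻¹ • M.toVertex a) = 1 := by
      intro g hg
      obtain ⟨k, hk⟩ := M.exists_eq_zpow_of_smul_baseVertex hg
      have hv : g⁻¹ • M.toVertex a =
          M.toVertex (M.artinDelta ^ (-k) * a * (M.artinDelta ^ (-k))⁻¹) := by
        rw [← zpow_neg, toVertex_mul_zpow, ← smul_toVertex, hk, ← zpow_neg]
        rfl
      have hne' : g⁻¹ • M.toVertex a ≠ M.baseVertex := by
        intro h
        rw [inv_smul_eq_iff, hg] at h
        exact hne h
      rw [hv] at hne' ⊢
      refine M.atomNorm_toVertex_eq_one (M.artinDelta_zpow_conj_mem_artinPos (-k) ha) ?_ hne'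
      rw [isPrefix_iff] at hD ⊢
      convert M.artinDelta_zpow_conj_mem_artinPos (-k) hD using 1
      group
    ext n
    constructor
    · rintro ⟨g, hg, rfl⟩
      exact hnorm g hg
    · rintro rfl
      exact ⟨1, one_smul _ _, hnorm 1 (one_smul _ _)⟩
  rw [atomDist, hset, csInf_singleton]

theorem atomDist_toVertex_eq_one {x y : M.ArtinGroup} (h1 : M.IsPrefix x y)
    (h2 : M.IsPrefix y (x * M.artinDelta)) (hne : M.toVertex x ≠ M.toVertex y) :
    M.atomDist (M.toVertex x) (M.toVertex y) = 1 := by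
  have hx : M.toVertex x = (x : M.ArtinQuot) • M.baseVertex := by
    rw [baseVertex, smul_toVertex, mul_one]
  have hy : M.toVertex y = (x : M.ArtinQuot) • M.toVertex (x⁻¹ * y) := by
    rw [smul_toVertex, mul_inv_cancel_left]
  rw [hx, hy, atomDist_smul]
  refine M.atomDist_baseVertex_eq_one (M.isPrefix_iff.mp h1) ?_ ?_
  · rwa [← M.isPrefix_mul_left_iff x, mul_inv_cancel_left]
  · intro h
    rw [hx, hy, h] at hne
    exact hne rfl

/-! ### Finite subgroups -/

/-- If `Δ` has length `0`, then there are no generators. -/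
theorem subsingleton_artinGroup
    (h : Multiplicative.toAdd (M.artinLength M.artinDelta) = 0) : Subsingleton M.ArtinGroup := by
  have hB : IsEmpty B := ⟨fun i => by
    have h1 := M.isLongest_artinDelta (M.toCoxeterSystem.simple i)
    rw [CoxeterSystem.length_simple] at h1
    have h2 := M.isAtomElt_artinDelta.2
    omega⟩
  refine ⟨fun a b => ?_⟩
  obtain ⟨a, rfl⟩ := PresentedGroup.mk_surjective _ a
  obtain ⟨b, rfl⟩ := PresentedGroup.mk_surjective _ b
  rw [Subsingleton.elim a b]

/-- For a finite subgroup `H` of `𝒢` with preimage `H̃` in the Artin group, the join `x` of the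
elements `h Δ^(-⌊ℓ(h) / ℓ(Δ)⌋)`, `h ∈ H̃`, is moved by `g ∈ H̃` by about `⌊ℓ(g) / ℓ(Δ)⌋` powers
of `Δ`. -/
theorem exists_almost_fixed (H : Subgroup M.ArtinQuot) [Finite H] :
    ∃ x : M.ArtinGroup, ∀ g : M.ArtinGroup, (g : M.ArtinQuot) ∈ H →
      ∃ k : ℤ, M.IsPrefix (x * M.artinDelta ^ k) (g * x) ∧
        M.IsPrefix (g * x) (x * M.artinDelta ^ (k + 1)) := by
  set L : ℤ := Multiplicative.toAdd (M.artinLength M.artinDelta) with hL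
  rcases (M.artinLength_nonneg M.isAtomElt_artinDelta.1).eq_or_lt with h0 | hpos
  · have := M.subsingleton_artinGroup h0.symm
    refine ⟨1, fun g _ => ⟨0, ?_, ?_⟩⟩ <;>
    · rw [isPrefix_iff, Subsingleton.elim (_⁻¹ * _ : M.ArtinGroup) 1]
      exact one_mem _
  rw [← hL] at hpos
  let ℓ : M.ArtinGroup → ℤ := fun h => Multiplicative.toAdd (M.artinLength h)
  have hℓ : ∀ g h, ℓ (g * h) = ℓ g + ℓ h := fun g h => by simp [ℓ]
  have hℓi : ∀ g, ℓ g⁻¹ = - ℓ g := fun g => by simp [ℓ]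
  let F : M.ArtinGroup → M.ArtinGroup := fun h => h * M.artinDelta ^ (-(ℓ h / L))
  -- `F h` depends only on the image of `h` in `𝒢`, so that the join is a finite one.
  have hF : ∀ h h' : M.ArtinGroup, (h : M.ArtinQuot) = h' → F h = F h' := by
    intro h h' hh
    obtain ⟨k, hk⟩ := M.exists_eq_artinDelta_sq_zpow (g := h⁻¹ * h') (by
      rw [QuotientGroup.mk_mul, QuotientGroup.mk_inv, hh, inv_mul_cancel])
    obtain rfl : h' = h * M.artinDelta ^ (2 * k) := by
      rw [zpow_mul, ← mul_inv_cancel_left h h', hk]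
      norm_cast
    have h2 : ℓ (h * M.artinDelta ^ (2 * k)) = ℓ h + 2 * k * L := by
      simp [ℓ, hL]
    simp only [F]
    rw [h2, Int.add_mul_ediv_right _ _ hpos.ne', mul_assoc, ← zpow_add]
    congr 2
    ring
  have hfin : (F '' {h | (h : M.ArtinQuot) ∈ H}).Finite := by
    refine ((Set.toFinite (H : Set M.ArtinQuot)).image fun q => F q.out).subset ?_
    rintro _ ⟨h, hh, rfl⟩
    exact ⟨h, hh, hF _ _ (QuotientGroup.out_eq' _)⟩
  obtain ⟨x, hx⟩ := M.exists_finset_join (s := hfin.toFinset)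
    ⟨F 1, by rw [Set.Finite.mem_toFinset]; exact ⟨1, one_mem H, rfl⟩⟩
  have hx' : ∀ c, M.IsPrefix x c ↔ ∀ h : M.ArtinGroup, (h : M.ArtinQuot) ∈ H →
      M.IsPrefix (F h) c := by
    intro c
    rw [hx]
    simp only [Set.Finite.mem_toFinset, Set.forall_mem_image]
    rfl
  have hle : ∀ h : M.ArtinGroup, (h : M.ArtinQuot) ∈ H → M.IsPrefix (F h) x :=
    (hx' x).mp (M.isPrefix_refl x)
  refine ⟨x, fun g hg => ⟨ℓ g / L, ?_, ?_⟩⟩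
  · rw [← M.isPrefix_mul_zpow_iff (-(ℓ g / L)), mul_assoc, ← zpow_add, add_neg_cancel, zpow_zero,
      mul_one, hx']
    intro h hh
    have hgh : ((g⁻¹ * h : M.ArtinGroup) : M.ArtinQuot) ∈ H := by
      rw [QuotientGroup.mk_mul, QuotientGroup.mk_inv]
      exact mul_mem (inv_mem hg) hh
    have h1 := hle _ hgh
    rw [← M.isPrefix_mul_left_iff g, ← M.isPrefix_mul_zpow_iff (-(ℓ g / L))] at h1
    refine IsPrefix.trans ?_ h1
    simp only [F]
    rw [← mul_assoc g, mul_inv_cancel_left, mul_assoc, ← zpow_add]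
    apply M.isPrefix_mul_zpow_of_le
    rw [hℓ, hℓi]
    have h2 : (-ℓ g + ℓ h) / L + ℓ g / L ≤ ℓ h / L := by
      rw [Int.le_ediv_iff_mul_le hpos, add_mul]
      have := Int.ediv_mul_le (-ℓ g + ℓ h) hpos.ne'
      have := Int.ediv_mul_le (ℓ g) hpos.ne'
      omega
    omega
  · rw [← M.isPrefix_mul_left_iff g⁻¹, inv_mul_cancel_left, hx']
    intro h hh
    have hgh : ((g * h : M.ArtinGroup) : M.ArtinQuot) ∈ H := by
      rw [QuotientGroup.mk_mul]
      exact mul_mem hg hh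
    have h1 := hle _ hgh
    rw [← M.isPrefix_mul_left_iff g⁻¹, ← M.isPrefix_mul_zpow_iff (ℓ g / L + 1)] at h1
    rw [← mul_assoc]
    refine IsPrefix.trans ?_ h1
    simp only [F]
    rw [mul_assoc g, inv_mul_cancel_left, mul_assoc, ← zpow_add]
    apply M.isPrefix_mul_zpow_of_le
    rw [hℓ]
    have h2 : (ℓ g + ℓ h) / L < ℓ g / L + ℓ h / L + 2 := by
      rw [Int.ediv_lt_iff_lt_mul hpos]
      have := Int.lt_ediv_add_one_mul_self (ℓ g) hpos
      have := Int.lt_ediv_add_one_mul_self (ℓ h) hpos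
      nlinarith
    omega

/-- The `H`-orbit of a vertex is a simplex of which `H` fixes the barycenter. -/
theorem exists_invariant_simplex (H : Subgroup M.ArtinQuot) [Finite H] :
    ∃ (σ : Finset M.Vertex) (hσ : σ ∈ M.artinComplex.faces),
      ∀ h ∈ H, h • (σ : Set M.Vertex) = (σ : Set M.Vertex) ∧
        h • M.artinComplex.barycenter σ hσ = M.artinComplex.barycenter σ hσ := by
  obtain ⟨x, hx⟩ := M.exists_almost_fixed H
  have hfin : ((fun h : M.ArtinQuot => h • M.toVertex x) '' (H : Set M.ArtinQuot)).Finite :=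
    (Set.toFinite _).image _
  have hmem : ∀ v, v ∈ hfin.toFinset ↔ ∃ h ∈ H, h • M.toVertex x = v := by
    intro v
    rw [Set.Finite.mem_toFinset]
    rfl
  have hinv : ∀ h ∈ H, ∀ v, h⁻¹ • v ∈ hfin.toFinset ↔ v ∈ hfin.toFinset := by
    intro h hh v
    rw [hmem, hmem]
    constructor
    · rintro ⟨k, hk, hkv⟩
      exact ⟨h * k, mul_mem hh hk, by rw [mul_smul, hkv, smul_inv_smul]⟩
    · rintro ⟨k, hk, hkv⟩
      exact ⟨h⁻¹ * k, mul_mem (inv_mem hh) hk, by rw [mul_smul, hkv]⟩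
  have hσ : hfin.toFinset ∈ M.artinComplex.faces := by
    refine ⟨⟨M.toVertex x, (hmem _).mpr ⟨1, one_mem H, one_smul _ _⟩⟩, ?_⟩
    intro v hv w hw hvw
    obtain ⟨g, hg, rfl⟩ := (hmem v).mp hv
    obtain ⟨h, hh, rfl⟩ := (hmem w).mp hw
    obtain ⟨u, hu⟩ := QuotientGroup.mk_surjective (g⁻¹ * h)
    have hh' : h = g * (u : M.ArtinQuot) := by rw [hu, mul_inv_cancel_left]
    obtain ⟨k, hk1, hk2⟩ := hx u (by rw [hu]; exact mul_mem (inv_mem hg) hh)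
    rw [← M.isPrefix_mul_zpow_iff (-k), mul_assoc, ← zpow_add, add_neg_cancel, zpow_zero,
      mul_one] at hk1
    rw [← M.isPrefix_mul_zpow_iff (-k), mul_assoc x, ← zpow_add,
      show k + 1 + -k = 1 by ring, zpow_one] at hk2
    have hux : (u : M.ArtinQuot) • M.toVertex x = M.toVertex (u * x * M.artinDelta ^ (-k)) := by
      rw [toVertex_mul_zpow, smul_toVertex]
    rw [hh', mul_smul, atomDist_smul, hux]
    refine M.atomDist_toVertex_eq_one hk1 hk2 fun heq => hvw ?_
    rw [hh', mul_smul, hux, ← heq]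
  refine ⟨hfin.toFinset, hσ, fun h hh => ⟨?_, ?_⟩⟩
  · ext v
    rw [Set.mem_smul_set_iff_inv_smul_mem]
    exact hinv h hh v
  · ext v
    change (M.artinComplex.barycenter _ hσ).weight (h⁻¹ • v) = _
    dsimp only [AbstractSimplicialComplex.barycenter]
    by_cases hv : v ∈ hfin.toFinset
    · rw [if_pos ((hinv h hh v).mpr hv), if_pos hv]
    · rw [if_neg (mt (hinv h hh v).mp hv), if_neg hv]

/-- Up to conjugation, a finite subgroup is contained in the finite set `⟨Δ⟩ · {atoms}`. -/
theorem finite_conjugacyClasses_finite_subgroups :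
    {C : Set (Subgroup M.ArtinQuot) | ∃ H : Subgroup M.ArtinQuot, Finite H ∧
      C = MulAction.orbit (ConjAct M.ArtinQuot) H}.Finite := by
  let F : Set M.ArtinQuot := (Subgroup.zpowers (M.artinDelta : M.ArtinQuot) : Set M.ArtinQuot) *
    ((fun a : M.ArtinGroup => (a : M.ArtinQuot)) '' {a | M.IsAtomElt a})
  have hF : F.Finite := by
    refine Set.Finite.mul ?_ (M.finite_setOf_isAtomElt.image _)
    have h2 : (M.artinDelta : M.ArtinQuot) ^ 2 = 1 := by
      rw [← QuotientGroup.mk_pow, QuotientGroup.eq_one_iff]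
      exact Subgroup.subset_normalClosure rfl
    have : IsOfFinOrder (M.artinDelta : M.ArtinQuot) :=
      isOfFinOrder_iff_pow_eq_one.mpr ⟨2, by norm_num, h2⟩
    exact finite_zpowers.mpr this
  have hfin : {K : Subgroup M.ArtinQuot | (K : Set M.ArtinQuot) ⊆ F}.Finite :=
    Set.Finite.preimage SetLike.coe_injective.injOn hF.finite_subsets
  refine (hfin.image fun K => MulAction.orbit (ConjAct M.ArtinQuot) K).subset ?_
  rintro _ ⟨H, hH, rfl⟩
  obtain ⟨x, hx⟩ := M.exists_almost_fixed H
  refine ⟨ConjAct.toConjAct (x : M.ArtinQuot)⁻¹ • H, ?_, MulAction.orbit_smul _ _⟩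
  rintro _ ⟨h, hh, rfl⟩
  obtain ⟨u, rfl⟩ := QuotientGroup.mk_surjective h
  obtain ⟨k, hk1, hk2⟩ := hx u hh
  rw [isPrefix_iff] at hk1
  refine ⟨(M.artinDelta : M.ArtinQuot) ^ k, ⟨k, rfl⟩, _, ⟨(x * M.artinDelta ^ k)⁻¹ * (u * x),
    M.isAtomElt_of_isPrefix_artinDelta hk1 ?_, rfl⟩, ?_⟩
  · rwa [← M.isPrefix_mul_left_iff (x * M.artinDelta ^ k), mul_inv_cancel_left, mul_assoc,
      ← zpow_add_one]
  · change (M.artinDelta : M.ArtinQuot) ^ k * (((x * M.artinDelta ^ k)⁻¹ * (u * x) :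
      M.ArtinGroup) : M.ArtinQuot) = (x : M.ArtinQuot)⁻¹ * u * (x : M.ArtinQuot)⁻¹⁻¹
    simp only [← QuotientGroup.mk_zpow, ← QuotientGroup.mk_inv, ← QuotientGroup.mk_mul]
    congr 1
    group

end CoxeterMatrix

theorem mainTheorem3 {B : Type*} [Finite B] (M : CoxeterMatrix B) [Finite M.Group] :
    -- every finite subgroup leaves a simplex invariant and fixes its barycenter
    (∀ H : Subgroup M.ArtinQuot, Finite H →
      ∃ (σ : Finset M.Vertex) (hσ : σ ∈ M.artinComplex.faces),
        ∀ h ∈ H, h • (σ : Set M.Vertex) = (σ : Set M.Vertex) ∧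
          h • M.artinComplex.barycenter σ hσ = M.artinComplex.barycenter σ hσ) ∧
    -- there are only finitely many conjugacy classes of finite subgroups
    {C : Set (Subgroup M.ArtinQuot) | ∃ H : Subgroup M.ArtinQuot, Finite H ∧
      C = MulAction.orbit (ConjAct M.ArtinQuot) H}.Finite := by
  exact ⟨fun H _ => M.exists_invariant_simplex H, M.finite_conjugacyClasses_finite_subgroups⟩
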